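/- **Nets.** A net $N=(S,T,F,M_0)$ consists of disjoint sets $S$ (places) and $T$ (transitions), a flow relation $F:(S\times T)\cup(T\times S)\to\mathbb N$ and an initial marking $M_0:S\to\mathbb N$, such that for every $t\in T$ the set $\{s\mid F(s,t)>0\}$ is finite and non-empty and $\{s\mid F(t,s)>0\}$ is finite. Write ${}^\bullet x(y)=F(y,x)$ and $x^\bullet(y)=F(x,y)$, extended additively to finite multisets of transitions. A finite non-empty multiset $G$ of transitions is a step $M\xrightarrow{G}M'$ if ${}^\bullet G\le M$ and $M'=(M-{}^\bullet G)+G^\bullet$. A marking is reachable if it is obtained from $M_0$ by firing a finite (possibly empty) word of transitions one after the other. $N$ is a *structural conflict net* if, for all $t,u\in T$ (possibly $t=u$), whenever the multiset $\{t,u\}$ is enabled in some reachable marking, ${}^\bullet t\cap{}^\bullet u=\emptyset$. **Processes.** A (GR-)process of $N$ is a pair $P=(\mathsf N,\pi)$ of a net $\mathsf N=(\mathsf S,\mathsf T,\mathsf F,\mathsf M_0)$ and a map $\pi:\mathsf S\cup\mathsf T\to S\cup T$ with $\pi(\mathsf S)\subseteq S$, $\pi(\mathsf T)\subseteq T$ such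 that: every $s\in\mathsf S$ satisfies $|{}^\bullet s|\le 1\ge|s^\bullet|$, and $\mathsf M_0(s)=1$ if ${}^\bullet s=\emptyset$, $\mathsf M_0(s)=0$ otherwise; the transitive closure $\mathsf F^+$ of $\{(x,y)\mid \mathsf F(x,y)>0\}$ is irreflexive; $\{t\in\mathsf T\mid (t,u)\in\mathsf F^+\}$ is finite for all $u\in\mathsf T$; $M_0(s)=|\pi^{-1}(s)\cap\mathsf M_0|$ for all $s\in S$; and $F(s,\pi(t))=|\pi^{-1}(s)\cap{}^\bullet t|$, $F(\pi(t),s)=|\pi^{-1}(s)\cap t^\bullet|$ for all $t\in\mathsf T$, $s\in S$. $P$ is finite if $\mathsf T$ is finite. A process $P'$ is a prefix of $P$ ($P'\le P$, and $P$ is an extension of $P'$) if $\mathsf S'\subseteq\mathsf S$, $\mathsf T'\subseteq\mathsf T$, $\mathsf M_0'=\mathsf M_0$ (as multisets), and $\mathsf F'$, $\pi'$ are the restrictions of $\mathsf F$, $\pi$. $P$ is *maximal* if it has no proper extension. **Swapping.** If $p,q\in\mathsf S$ satisfy $\pi(p)=\pi(q)$ and $(p,q),(q,p)\notin\mathsf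 F^+$, then $\mathrm{swap}(P,p,q)$ is obtained from $P$ by exchanging the outgoing arcs of $p$ and $q$. Write $P\approx_s Q$ if $\mathrm{swap}(P,p,q)$ is isomorphic to $Q$ for some such $p,q$ (isomorphisms of nets commuting with the maps to $N$), and let $\approx_s^*$ be the reflexive and transitive closure, isomorphic processes being identified. For a finite process $P$ let $[P]$ be its $\approx_s^*$-class, a finite BD-process, and write $[P']\le[P]$ if $P'\approx_s^*Q'\le Q\approx_s^*P$ for some $Q',Q$. A *BD-run* is a non-empty set of finite BD-processes that is closed under prefixes and directed with respect to $\le$; it is *maximal* if it is not properly contained in another BD-run. For an arbitrary process $P$ let $BD(P)$ be the prefix-closure (under $\le$) of $\{[P']\mid P'\le P,\ P'\text{ finite}\}$. Write $P\approx_s^\infty Q$ if $BD(P)=BD(Q)$; the class of $P$ under $\approx_s^\infty$ is the *BD-process* $[P]_\infty$. It is *weakly maximal* if some $P'\in[P]_\infty$ is a maximal process, and *run-maximal* if the BD-run $BD(P)$ is maximal. **Lemma.** Let $N$ be a structural conflict net and $P$ a GR-process of $N$. 1. If the BD-run $BD(P)$ is not maximal, then $P$ is not maximal. 2. If $[P]_\infty$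 is weakly maximal, then $[P]_\infty$ is run-maximal. -/

import Mathlib

universe u

/-- A multiset over `X` is a function `A : X → ℕ`; its cardinality `∑ x, A x`, possibly infinite,
is the number of its elements counted with multiplicity. -/
noncomputable def multisetCard {X : Type u} (A : X → ℕ) : ℕ∞ :=
  ENat.card (Σ x, Fin (A x))

/-- A place/transition system (briefly: a net) with arc weights and an initial marking.
The flow relation `F` is given by its two parts `pre s t = F(s, t)` and `post t s = F(t, s)`. -/
structure PetriNet : Type (u + 1) where
  Place : Type u
  Trans : Type u
  pre : Place → Trans → ℕ
  post : Trans → Place → ℕ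
  M₀ : Place → ℕ
  pre_finite : ∀ t, {s | 0 < pre s t}.Finite
  pre_nonempty : ∀ t, {s | 0 < pre s t}.Nonempty
  post_finite : ∀ t, {s | 0 < post t s}.Finite

namespace PetriNet

/-! ### Firing -/

/-- The marking consumed by a finite multiset `G` of transitions. -/
def preset (N : PetriNet.{u}) (G : Multiset N.Trans) (s : N.Place) : ℕ :=
  (G.map fun t => N.pre s t).sum

/-- The marking produced by a finite multiset `G` of transitions. -/
def postset (N : PetriNet.{u}) (G : Multiset N.Trans) (s : N.Place) : ℕ :=
  (G.map fun t => N.post t s).sum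

/-- The finite, non-empty multiset `G` is a step from `M` to `M'`.
The subtraction is truncated, but `G` is enabled anyway. -/
def Step (N : PetriNet.{u}) (M : N.Place → ℕ) (G : Multiset N.Trans) (M' : N.Place → ℕ) : Prop :=
  G ≠ 0 ∧ (∀ s, N.preset G s ≤ M s) ∧ ∀ s, M' s = (M s - N.preset G s) + N.postset G s

/-- Firing a word of transitions, one after the other. -/
def Fires (N : PetriNet.{u}) : (N.Place → ℕ) → List N.Trans → (N.Place → ℕ) → Prop
  | M, [], M' => M = M'
  | M, t :: σ, M' => ∃ M₁, N.Step M {t} M₁ ∧ N.Fires M₁ σ M'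

/-- The markings reachable from the initial one. -/
def Reachable (N : PetriNet.{u}) (M : N.Place → ℕ) : Prop :=
  ∃ σ, N.Fires N.M₀ σ M

/-- A structural conflict net: if `{t, u}` (possibly `t = u`) is enabled in a reachable marking,
then `t` and `u` do not share a preplace. -/
def IsStructuralConflictNet (N : PetriNet.{u}) : Prop :=
  ∀ (t u : N.Trans) (M M' : N.Place → ℕ), N.Reachable M → N.Step M {t, u} M' →
    ∀ s, min (N.pre s t) (N.pre s u) = 0

/-! ### Causality -/

/-- The relation `{(x, y) | F(x, y) > 0}` on places and transitions. -/
def Flow (N : PetriNet.{u}) : N.Place ⊕ N.Trans → N.Place ⊕ N.Trans → Prop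
  | .inl s, .inr t => 0 < N.pre s t
  | .inr t, .inl s => 0 < N.post t s
  | _, _ => False

/-- The transitive closure of the flow relation. -/
def Causes (N : PetriNet.{u}) : N.Place ⊕ N.Trans → N.Place ⊕ N.Trans → Prop :=
  Relation.TransGen N.Flow

/-! ### Processes -/

/-- A net together with a map `π` to a net `N`, sending places to places and transitions to
transitions. -/
structure MappedNet (N : PetriNet.{u}) : Type (u + 1) where
  net : PetriNet.{u}
  πS : net.Place → N.Place
  πT : net.Trans → N.Trans

/-- The conditions under which a mapped net is a GR-process. -/
structure IsGRProcess {N : PetriNet.{u}} (P : MappedNet N) : Prop where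
  card_pre_le : ∀ s, multisetCard (fun t => P.net.post t s) ≤ 1
  card_post_le : ∀ s, multisetCard (fun t => P.net.pre s t) ≤ 1
  marked : ∀ s, (∀ t, P.net.post t s = 0) → P.net.M₀ s = 1
  unmarked : ∀ s, (¬ ∀ t, P.net.post t s = 0) → P.net.M₀ s = 0
  acyclic : ∀ x, ¬ P.net.Causes x x
  finite_past : ∀ v : P.net.Trans, {t | P.net.Causes (.inr t) (.inr v)}.Finite
  map_M₀ : ∀ s, (N.M₀ s : ℕ∞) = {x | P.πS x = s ∧ 0 < P.net.M₀ x}.encard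
  map_pre : ∀ t s, (N.pre s (P.πT t) : ℕ∞) = {x | P.πS x = s ∧ 0 < P.net.pre x t}.encard
  map_post : ∀ t s, (N.post (P.πT t) s : ℕ∞) = {x | P.πS x = s ∧ 0 < P.net.post t x}.encard

/-- The GR-processes of `N`. -/
structure GRProcess (N : PetriNet.{u}) extends MappedNet N where
  valid : IsGRProcess toMappedNet

/-- An isomorphism of nets that respects the maps to `N`. -/
structure MappedNet.Iso {N : PetriNet.{u}} (P Q : MappedNet N) where
  φS : P.net.Place ≃ Q.net.Place
  φT : P.net.Trans ≃ Q.net.Trans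
  M₀_eq : ∀ s, Q.net.M₀ (φS s) = P.net.M₀ s
  pre_eq : ∀ s t, Q.net.pre (φS s) (φT t) = P.net.pre s t
  post_eq : ∀ t s, Q.net.post (φT t) (φS s) = P.net.post t s
  πS_eq : ∀ s, Q.πS (φS s) = P.πS s
  πT_eq : ∀ t, Q.πT (φT t) = P.πT t

/-- An embedding of `P'` as a prefix of `P`. If it is an inclusion of sets, then it says that the
places and transitions of `P'` are among those of `P`, that both have the same initial marking,
and that `F'` and `π'` are the restrictions of `F` and `π`. -/
structure GRProcess.PrefixEmbedding {N : PetriNet.{u}} (P' P : GRProcess N) where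
  fS : P'.net.Place ↪ P.net.Place
  fT : P'.net.Trans ↪ P.net.Trans
  M₀_eq : ∀ s, P.net.M₀ (fS s) = P'.net.M₀ s
  M₀_outside : ∀ s, s ∉ Set.range fS → P.net.M₀ s = 0
  pre_eq : ∀ s t, P.net.pre (fS s) (fT t) = P'.net.pre s t
  post_eq : ∀ t s, P.net.post (fT t) (fS s) = P'.net.post t s
  πS_eq : ∀ s, P.πS (fS s) = P'.πS s
  πT_eq : ∀ t, P.πT (fT t) = P'.πT t

/-- `P'` is (up to isomorphism) a prefix of `P`, and `P` an extension of `P'`. -/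
def GRProcess.Prefix {N : PetriNet.{u}} (P' P : GRProcess N) : Prop :=
  Nonempty (P'.PrefixEmbedding P)

/-- `P` has no proper extension: every embedding of `P` as a prefix of a process `Q` hits all
places and all transitions of `Q`. -/
def GRProcess.IsMaximal {N : PetriNet.{u}} (P : GRProcess N) : Prop :=
  ¬ ∃ (Q : GRProcess N) (f : P.PrefixEmbedding Q),
    ¬ (Function.Surjective f.fS ∧ Function.Surjective f.fT)

/-- A process is finite if it has finitely many transitions. -/
def GRProcess.IsFinite {N : PetriNet.{u}} (P : GRProcess N) : Prop :=
  Finite P.net.Trans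

/-! ### Swapping -/

open Classical in
/-- Exchange the outgoing arcs of the places `p` and `q`. -/
noncomputable def MappedNet.swap {N : PetriNet.{u}} (P : MappedNet N) (p q : P.net.Place) :
    MappedNet N where
  net :=
    { Place := P.net.Place
      Trans := P.net.Trans
      pre := fun x t => P.net.pre (Equiv.swap p q x) t
      post := P.net.post
      M₀ := P.net.M₀
      pre_finite := fun t =>
        Set.Finite.preimage (f := Equiv.swap p q) (Equiv.injective _).injOn (P.net.pre_finite t)
      pre_nonempty := fun t => by
        obtain ⟨s, hs⟩ := P.net.pre_nonempty t
        exact ⟨Equiv.swap p q s, by simpa using hs⟩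
      post_finite := P.net.post_finite }
  πS := P.πS
  πT := P.πT

/-- The places `p` and `q` may be swapped: they are causally unrelated and represent the same
place of `N`. -/
def MappedNet.Swappable {N : PetriNet.{u}} (P : MappedNet N) (p q : P.net.Place) : Prop :=
  ¬ P.net.Causes (.inl p) (.inl q) ∧ ¬ P.net.Causes (.inl q) (.inl p) ∧ P.πS p = P.πS q

/-- One step swapping equivalence. -/
def GRProcess.OneStepSwap {N : PetriNet.{u}} (P Q : GRProcess N) : Prop :=
  ∃ p q : P.net.Place, P.Swappable p q ∧
    Nonempty ((P.toMappedNet.swap p q).Iso Q.toMappedNet)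

/-- The reflexive and transitive closure of one step swapping equivalence, where reflexivity is
understood up to isomorphism. (As `p = q` is allowed in a swap, isomorphic processes that have a
place are one step swapping equivalent anyway.) -/
def GRProcess.SwapEquiv {N : PetriNet.{u}} : GRProcess N → GRProcess N → Prop :=
  Relation.ReflTransGen fun P Q =>
    Nonempty (P.toMappedNet.Iso Q.toMappedNet) ∨ P.OneStepSwap Q

/-- Isomorphisms can be inverted. -/
def MappedNet.Iso.symm {N : PetriNet.{u}} {P Q : MappedNet N} (e : P.Iso Q) : Q.Iso P where
  φS := e.φS.symm
  φT := e.φT.symm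
  M₀_eq s := by rw [← e.M₀_eq, Equiv.apply_symm_apply]
  pre_eq s t := by rw [← e.pre_eq, Equiv.apply_symm_apply, Equiv.apply_symm_apply]
  post_eq t s := by rw [← e.post_eq, Equiv.apply_symm_apply, Equiv.apply_symm_apply]
  πS_eq s := by rw [← e.πS_eq, Equiv.apply_symm_apply]
  πT_eq t := by rw [← e.πT_eq, Equiv.apply_symm_apply]

theorem MappedNet.Iso.causes {N : PetriNet.{u}} {P Q : MappedNet N} (e : P.Iso Q)
    {x y : P.net.Place ⊕ P.net.Trans} (h : P.net.Causes x y) :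
    Q.net.Causes (Sum.map e.φS e.φT x) (Sum.map e.φS e.φT y) := by
  refine Relation.TransGen.lift (Sum.map e.φS e.φT) ?_ _ _ h
  rintro (s | t) (s' | t') hxy
  · exact hxy
  · exact lt_of_lt_of_eq (show 0 < P.net.pre s t' from hxy) (e.pre_eq s t').symm
  · exact lt_of_lt_of_eq (show 0 < P.net.post t s' from hxy) (e.post_eq t s').symm
  · exact hxy

open Classical in
/-- Causality after a swap, in terms of causality before. -/
theorem MappedNet.swap_causes {N : PetriNet.{u}} (P : MappedNet N) (p q a : P.net.Place)
    {y : P.net.Place ⊕ P.net.Trans}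
    (h : (P.swap p q).net.Causes (.inl ((Equiv.swap p q) a)) y) :
    P.net.Causes (.inl a) y ∨ P.net.Causes (.inl a) (.inl p) ∨
      P.net.Causes (.inl a) (.inl q) := by
  classical
  induction h with
  | single h =>
    rename_i b
    rcases b with s | t
    · exact h.elim
    · refine Or.inl (Relation.TransGen.single ?_)
      simpa [Flow, MappedNet.swap] using h
  | tail _ h ih =>
    rename_i b c _
    rcases ih with ih | ih
    · rcases b with s | t
      · by_cases hp : s = p
        · subst hp; exact Or.inr (Or.inl ih)
        by_cases hq : s = q
        · subst hq; exact Or.inr (Or.inr ih)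
        refine Or.inl (Relation.TransGen.tail ih ?_)
        rcases c with s' | t'
        · exact h.elim
        · simpa [Flow, MappedNet.swap, Equiv.swap_apply_of_ne_of_ne hp hq] using h
      · refine Or.inl (Relation.TransGen.tail ih ?_)
        rcases c with s' | t'
        · exact h
        · exact h.elim
    · exact Or.inr ih

theorem GRProcess.OneStepSwap.symm {N : PetriNet.{u}} {P Q : GRProcess N} (h : P.OneStepSwap Q) :
    Q.OneStepSwap P := by
  classical
  obtain ⟨p, q, ⟨hpq, hqp, hπ⟩, ⟨e⟩⟩ := h
  have hp := P.valid.acyclic (.inl p)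
  have hq := P.valid.acyclic (.inl q)
  let φS : P.net.Place ≃ Q.net.Place := e.φS
  let φT : P.net.Trans ≃ Q.net.Trans := e.φT
  have hpre : ∀ s t, Q.net.pre (φS s) (φT t) = P.net.pre (Equiv.swap p q s) t := e.pre_eq
  have hc : ∀ a b, Q.net.Causes (.inl (φS a)) (.inl (φS b)) →
      (P.swap p q).net.Causes (.inl a) (.inl b) := fun a b h => by
    have h1 : (P.swap p q).net.Causes (.inl (φS.symm (φS a))) (.inl (φS.symm (φS b))) :=
      e.symm.causes h
    rwa [Equiv.symm_apply_apply, Equiv.symm_apply_apply] at h1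
  refine ⟨φS p, φS q, ⟨fun h => ?_, fun h => ?_, ?_⟩, ⟨?_⟩⟩
  · have h2 := P.toMappedNet.swap_causes p q q (y := .inl q)
      (by rw [Equiv.swap_apply_right]; exact hc p q h)
    tauto
  · have h2 := P.toMappedNet.swap_causes p q p (y := .inl p)
      (by rw [Equiv.swap_apply_left]; exact hc q p h)
    tauto
  · exact (e.πS_eq p).trans (hπ.trans (e.πS_eq q).symm)
  · have key : ∀ (s : Q.net.Place) (t : Q.net.Trans), P.net.pre (φS.symm s) (φT.symm t) =
        Q.net.pre (Equiv.swap (φS p) (φS q) s) t := by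
      intro s t
      have h1 : Equiv.swap (φS p) (φS q) s = φS (Equiv.swap p q (φS.symm s)) := by
        rw [← Equiv.symm_trans_swap_trans p q φS]; rfl
      have h2 := hpre (Equiv.swap p q (φS.symm s)) (φT.symm t)
      rw [show Equiv.swap p q (Equiv.swap p q (φS.symm s)) = φS.symm s from by simp, Equiv.apply_symm_apply] at h2
      rw [h1, h2]
    exact
      { φS := φS.symm
        φT := φT.symm
        M₀_eq := e.symm.M₀_eq
        pre_eq := key
        post_eq := e.symm.post_eq
        πS_eq := e.symm.πS_eq
        πT_eq := e.symm.πT_eq }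

/-- Swapping equivalence of processes, as a setoid. -/
def swapSetoid (N : PetriNet.{u}) : Setoid (GRProcess N) where
  r := GRProcess.SwapEquiv
  iseqv :=
    { refl := fun _ => Relation.ReflTransGen.refl
      symm := fun {P Q} h => by
        induction h with
        | refl => exact Relation.ReflTransGen.refl
        | tail _ h ih =>
          refine Relation.ReflTransGen.head ?_ ih
          rcases h with ⟨⟨e⟩⟩ | h
          · exact Or.inl ⟨e.symm⟩
          · exact Or.inr h.symm
      trans := fun h h' => Relation.ReflTransGen.trans h h' }

/-! ### BD-processes and BD-runs -/

/-- Finite BD-processes: the swapping equivalence classes of finite processes. -/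
def FiniteBDProcess (N : PetriNet.{u}) : Type (u + 1) :=
  Quotient ((swapSetoid N).comap (Subtype.val : {P : GRProcess N // P.IsFinite} → GRProcess N))

/-- The swapping equivalence class of a finite process. -/
def GRProcess.finiteBD {N : PetriNet.{u}} (P : GRProcess N) (hP : P.IsFinite) : FiniteBDProcess N :=
  Quotient.mk _ ⟨P, hP⟩

/-- The prefix relation lifted to finite BD-processes: it holds between two classes if it holds
between some representatives. -/
def FiniteBDProcess.Prefix {N : PetriNet.{u}} (c d : FiniteBDProcess N) : Prop :=
  ∃ (P Q : GRProcess N) (hP : P.IsFinite) (hQ : Q.IsFinite),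
    P.finiteBD hP = c ∧ Q.finiteBD hQ = d ∧ P.Prefix Q

/-- BD-runs: non-empty, prefix-closed and directed sets of finite BD-processes. -/
structure IsBDRun {N : PetriNet.{u}} (R : Set (FiniteBDProcess N)) : Prop where
  nonempty : R.Nonempty
  prefix_closed : ∀ c d, c.Prefix d → d ∈ R → c ∈ R
  directed : ∀ c ∈ R, ∀ d ∈ R, ∃ e ∈ R, c.Prefix e ∧ d.Prefix e

/-- A maximal BD-run: a BD-run that is not properly contained in another one. -/
def IsMaximalBDRun {N : PetriNet.{u}} (R : Set (FiniteBDProcess N)) : Prop :=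
  IsBDRun R ∧ ∀ R' : Set (FiniteBDProcess N), IsBDRun R' → R ⊆ R' → R' = R

/-- The BD-run `BD(P)` of a process `P`: the prefix-closure of the set of classes of the finite
prefixes of `P`. -/
def GRProcess.BD {N : PetriNet.{u}} (P : GRProcess N) : Set (FiniteBDProcess N) :=
  {c | ∃ (P' : GRProcess N) (hP' : P'.IsFinite), P'.Prefix P ∧ c.Prefix (P'.finiteBD hP')}

/-- BD-processes: the classes of arbitrary processes modulo swapping equivalence `≈ₛ^∞`, where
`P ≈ₛ^∞ Q` means `BD(P) = BD(Q)`. -/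
def BDProcess (N : PetriNet.{u}) : Type (u + 1) :=
  Quotient (Setoid.ker (GRProcess.BD (N := N)))

/-- The BD-process of a process. -/
def GRProcess.bdClass {N : PetriNet.{u}} (P : GRProcess N) : BDProcess N :=
  Quotient.mk _ P

/-- The BD-run of a BD-process, `BD(P)` for any representative `P`. -/
def BDProcess.run {N : PetriNet.{u}} (c : BDProcess N) : Set (FiniteBDProcess N) :=
  Quotient.lift GRProcess.BD (fun _ _ h => h) c

/-- A BD-process is weakly maximal if one of its representatives is a maximal process. -/
def BDProcess.WeaklyMaximal {N : PetriNet.{u}} (c : BDProcess N) : Prop :=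
  ∃ P : GRProcess N, P.bdClass = c ∧ P.IsMaximal

/-- A BD-process is run-maximal if its BD-run is a maximal BD-run. -/
def BDProcess.RunMaximal {N : PetriNet.{u}} (c : BDProcess N) : Prop :=
  IsMaximalBDRun c.run

end PetriNet

/-! In a structural conflict net, two transitions of a process whose labels share a preplace `s` are
causally ordered: otherwise, after their joint past, both would be enabled at once
(`GRProcess.comparable`). Hence all linearisations of a finite process show the same sequence of
labels consuming from `s`, its trace at `s`. Swapping does not change traces, because causally
unrelated places can be marked simultaneously and a linearisation through that moment survives the
swap (`GRProcess.OneStepSwap.trace_eq`).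

Traces in fact determine the order on finite BD-processes: one class is below another iff at every
place its trace is an initial part of the other's (`finiteBD_prefix_iff`). For the converse
direction, the smaller process is embedded one transition at a time, swapping tokens in the larger
one until preplaces match (`PartialEmbedding.exists_extend`).

Now let `P` be maximal and let a BD-run containing `BD(P)` have a member outside it. Linearise that
member and stop at the first transition `t` whose execution leaves `BD(P)`; let `α` be the word
before it, covered by a history `τ` of `P`. By directedness, every history of `P` agrees at each
place with the linearisation as far as both go. If some extension of `τ` consumed more than `α` from
one preplace of `t`, its next consumer there would be `t`; counting occurrences of `t` would give
the same at all preplaces, so `t` after `α` would be covered as well. Thus `P` never consumes more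
from the preplaces of `t` than `α` does, the tokens needed by `t` stay unconsumed, and an occurrence
of `t` can be added to `P` (`GRProcess.not_isMaximal_of_unconsumed`), a contradiction. Both claims
follow.

Words and histories are listed with the latest transition first, so initial parts of executions
appear as list suffixes. -/

/-! ### Counting lemmas for multisets and labelled sets -/

theorem multisetCard_le_one_iff {X : Type u} (A : X → ℕ) :
    multisetCard A ≤ 1 ↔ (∀ x, A x ≤ 1) ∧ ∀ x y, 0 < A x → 0 < A y → x = y := by
  unfold multisetCard
  rw [ENat.card_le_one_iff_subsingleton]
  constructor
  · intro h
    refine ⟨fun x => ?_, fun x y hx hy => ?_⟩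
    · by_contra! hx
      have := h.elim (⟨x, ⟨0, by omega⟩⟩ : Σ x, Fin (A x)) ⟨x, ⟨1, hx⟩⟩
      simp at this
    · have := h.elim (⟨x, ⟨0, hx⟩⟩ : Σ x, Fin (A x)) ⟨y, ⟨0, hy⟩⟩
      exact congrArg Sigma.fst this
  · rintro ⟨h1, h2⟩
    refine ⟨?_⟩
    rintro ⟨x, i⟩ ⟨y, j⟩
    obtain rfl := h2 x y i.pos j.pos
    have := h1 x
    congr 1
    ext
    omega

/-- A bijection between two sets that respects given labellings with finite fibres. -/
theorem Set.exists_bijOn_of_encard_fiber_eq {α β γ : Type*} [Nonempty β] (A : Set α) (B : Set β)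
    (f : α → γ) (g : β → γ) (k : γ → ℕ) (hA : ∀ c, (k c : ℕ∞) = {a | f a = c ∧ a ∈ A}.encard)
    (hB : ∀ c, (k c : ℕ∞) = {b | g b = c ∧ b ∈ B}.encard) :
    ∃ h : α → β, Set.BijOn h A B ∧ ∀ a ∈ A, g (h a) = f a := by
  have key : ∀ c, ∃ h : α → β, Set.BijOn h {a | f a = c ∧ a ∈ A} {b | g b = c ∧ b ∈ B} := fun c =>
    (Set.finite_of_encard_eq_coe (hA c).symm).exists_bijOn_of_encard_eq ((hA c).symm.trans (hB c))
  choose F hF using key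
  refine ⟨fun a => F (f a) a, ⟨fun a ha => ((hF (f a)).mapsTo ⟨rfl, ha⟩).2, ?_, ?_⟩,
    fun a ha => ((hF (f a)).mapsTo ⟨rfl, ha⟩).1⟩
  · intro a ha b hb hab
    have h1 := ((hF (f a)).mapsTo ⟨rfl, ha⟩).1
    have h2 := ((hF (f b)).mapsTo ⟨rfl, hb⟩).1
    simp only at hab
    have h3 : f a = f b := by rw [← h1, ← h2, hab]
    rw [← h3] at hab
    exact (hF (f a)).injOn ⟨rfl, ha⟩ ⟨h3.symm, hb⟩ hab
  · intro b hb
    obtain ⟨a, ⟨ha, haA⟩, hab⟩ := (hF (g b)).surjOn ⟨rfl, hb⟩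
    exact ⟨a, haA, by simp only [ha, hab]⟩

/-- Sets with the same finite number of elements of each label are equal if one contains the
other. -/
theorem Set.eq_of_subset_of_encard_fiber_eq {α γ : Type*} {A B : Set α} (f : α → γ) (k : γ → ℕ)
    (hA : ∀ c, (k c : ℕ∞) = {a | f a = c ∧ a ∈ A}.encard)
    (hB : ∀ c, (k c : ℕ∞) = {a | f a = c ∧ a ∈ B}.encard) (h : A ⊆ B) : A = B := by
  refine h.antisymm fun b hb => ?_
  have h0 : {a | f a = f b ∧ a ∈ A} ⊆ {a | f a = f b ∧ a ∈ B} := fun a ha => ⟨ha.1, h ha.2⟩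
  have h1 := (Set.finite_of_encard_eq_coe (hA (f b)).symm).eq_of_subset_of_encard_le h0
    (by rw [← hA, ← hB])
  have h2 : b ∈ {a | f a = f b ∧ a ∈ B} := ⟨rfl, hb⟩
  rw [← h1] at h2
  exact h2.2

namespace PetriNet

/-! ### Markings reached by words -/

@[simp] theorem preset_cons (N : PetriNet.{u}) (t : N.Trans) (G : Multiset N.Trans) (s : N.Place) :
    N.preset (t ::ₘ G) s = N.pre s t + N.preset G s := by
  simp [preset]

@[simp] theorem postset_cons (N : PetriNet.{u}) (t : N.Trans) (G : Multiset N.Trans)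
    (s : N.Place) : N.postset (t ::ₘ G) s = N.post t s + N.postset G s := by
  simp [postset]

@[simp] theorem preset_zero (N : PetriNet.{u}) (s : N.Place) : N.preset 0 s = 0 := by
  simp [preset]

@[simp] theorem postset_zero (N : PetriNet.{u}) (s : N.Place) : N.postset 0 s = 0 := by
  simp [postset]

@[simp] theorem preset_singleton (N : PetriNet.{u}) (t : N.Trans) (s : N.Place) :
    N.preset {t} s = N.pre s t := by
  simp [preset]

@[simp] theorem postset_singleton (N : PetriNet.{u}) (t : N.Trans) (s : N.Place) :
    N.postset {t} s = N.post t s := by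
  simp [postset]

theorem postset_mono (N : PetriNet.{u}) {G H : Multiset N.Trans} (h : G ≤ H) (s : N.Place) :
    N.postset G s ≤ N.postset H s := by
  obtain ⟨K, rfl⟩ := Multiset.le_iff_exists_add.1 h
  simp [postset]

/-- The marking after firing the transitions of `G` in some order. -/
def marking (N : PetriNet.{u}) (G : Multiset N.Trans) (s : N.Place) : ℕ :=
  N.M₀ s + N.postset G s - N.preset G s

/-- The word `w`, written with the last transition first, can be fired from the initial marking. -/
def Fireable (N : PetriNet.{u}) : List N.Trans → Prop
  | [] => True
  | t :: w => N.Fireable w ∧ ∀ s, N.preset (t ::ₘ w) s ≤ N.M₀ s + N.postset w s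

theorem Fires.snoc {N : PetriNet.{u}} {M M' M'' : N.Place → ℕ} {σ : List N.Trans} {t : N.Trans}
    (h : N.Fires M σ M') (h' : N.Step M' {t} M'') : N.Fires M (σ ++ [t]) M'' := by
  induction σ generalizing M with
  | nil => obtain rfl : M = M' := h; exact ⟨M'', h', rfl⟩
  | cons u σ ih =>
    obtain ⟨M₁, h1, h2⟩ := h
    exact ⟨M₁, h1, ih h2⟩

/-- The enabling condition at each step is exactly what keeps the truncated subtraction in `marking`
from losing tokens. -/
theorem Fireable.reachable {N : PetriNet.{u}} {w : List N.Trans} (h : N.Fireable w) :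
    N.Reachable (N.marking w) := by
  induction w with
  | nil => exact ⟨[], funext fun s => by simp [marking]⟩
  | cons t w ih =>
    obtain ⟨h1, h2⟩ := h
    obtain ⟨σ, hσ⟩ := ih h1
    refine ⟨σ ++ [t], hσ.snoc ⟨by simp, fun s => ?_, fun s => ?_⟩⟩ <;>
      have := h2 s <;>
      simp only [marking, ← Multiset.cons_coe, preset_cons, postset_cons, preset_singleton,
        postset_singleton] at this ⊢ <;> omega

/-! ### Histories -/

/-- The preplaces of a transition. -/
def inputs (K : PetriNet.{u}) (t : K.Trans) : Set K.Place := {p | 0 < K.pre p t}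

/-- The postplaces of a transition. -/
def outputs (K : PetriNet.{u}) (t : K.Trans) : Set K.Place := {p | 0 < K.post t p}

/-- The places that are marked initially or by a transition in `σ`. -/
def produced (K : PetriNet.{u}) (σ : List K.Trans) : Set K.Place :=
  {p | 0 < K.M₀ p ∨ ∃ t ∈ σ, p ∈ K.outputs t}

/-- The preplaces of the transitions in `σ`. -/
def consumed (K : PetriNet.{u}) (σ : List K.Trans) : Set K.Place :=
  {p | ∃ t ∈ σ, p ∈ K.inputs t}

/-- An enumeration, with the last transition first, of a causally closed set of transitions. -/
def History (K : PetriNet.{u}) : List K.Trans → Prop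
  | [] => True
  | t :: σ => K.History σ ∧ t ∉ σ ∧ K.inputs t ⊆ K.produced σ

/-- Every place has at most one incoming arc, and none if it is marked. -/
structure Backward (K : PetriNet.{u}) : Prop where
  unmarked : ∀ t p, p ∈ K.outputs t → K.M₀ p = 0
  unique : ∀ t t' p, p ∈ K.outputs t → p ∈ K.outputs t' → t = t'

variable {K N : PetriNet.{u}}

theorem produced_cons (t : K.Trans) (σ : List K.Trans) :
    K.produced (t :: σ) = K.produced σ ∪ K.outputs t := by
  ext p
  constructor
  · rintro (hp | ⟨u, hu, hp⟩)
    · exact Or.inl (Or.inl hp)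
    · rcases List.mem_cons.1 hu with rfl | hu
      · exact Or.inr hp
      · exact Or.inl (Or.inr ⟨u, hu, hp⟩)
  · rintro ((hp | ⟨u, hu, hp⟩) | hp)
    · exact Or.inl hp
    · exact Or.inr ⟨u, List.mem_cons_of_mem _ hu, hp⟩
    · exact Or.inr ⟨t, List.mem_cons_self, hp⟩

theorem consumed_cons (t : K.Trans) (σ : List K.Trans) :
    K.consumed (t :: σ) = K.inputs t ∪ K.consumed σ := by
  ext p
  simp [consumed]

theorem produced_mono {σ τ : List K.Trans} (h : σ ⊆ τ) : K.produced σ ⊆ K.produced τ := by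
  rintro p (hp | ⟨t, ht, hp⟩)
  · exact Or.inl hp
  · exact Or.inr ⟨t, h ht, hp⟩

theorem History.nodup {σ : List K.Trans} (h : K.History σ) : σ.Nodup := by
  induction σ with
  | nil => exact List.nodup_nil
  | cons t σ ih => exact List.nodup_cons.2 ⟨h.2.1, ih h.1⟩

theorem History.of_append {σ τ : List K.Trans} (h : K.History (τ ++ σ)) : K.History σ := by
  induction τ with
  | nil => exact h
  | cons t τ ih => exact ih h.1

theorem History.consumed_subset {σ : List K.Trans} (h : K.History σ) :
    K.consumed σ ⊆ K.produced σ := by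
  induction σ with
  | nil => rintro p ⟨t, ht, -⟩; simp at ht
  | cons t σ ih =>
    rw [consumed_cons, produced_cons]
    exact (Set.union_subset h.2.2 (ih h.1)).trans Set.subset_union_left

theorem History.inputs_subset {σ : List K.Trans} (h : K.History σ) {t : K.Trans} (ht : t ∈ σ) :
    K.inputs t ⊆ K.produced σ := fun _ hp => h.consumed_subset ⟨t, ht, hp⟩

/-- Histories are closed under causes. -/
theorem History.closed {σ : List K.Trans} (h : K.History σ) (hK : K.Backward)
    {x y : K.Place ⊕ K.Trans} (hxy : K.Causes x y)
    (hy : Sum.elim (· ∈ K.produced σ) (· ∈ σ) y) : Sum.elim (· ∈ K.produced σ) (· ∈ σ) x := by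
  have step : ∀ a b, K.Flow a b → Sum.elim (· ∈ K.produced σ) (· ∈ σ) b →
      Sum.elim (· ∈ K.produced σ) (· ∈ σ) a := by
    rintro (p | t) (q | u) hab hb
    · exact hab.elim
    · exact h.inputs_subset hb hab
    · rcases hb with hb | ⟨u, hu, hq⟩
      · exact absurd (hK.unmarked t q hab) hb.ne'
      · exact hK.unique u t q hq hab ▸ hu
    · exact hab.elim
  induction hxy using Relation.TransGen.head_induction_on with
  | single h1 => exact step _ _ h1 hy
  | head h1 _ ih => exact step _ _ h1 ih

/-- Since `σ` is causally closed and omits `t`, nothing in `σ` depends on `t`. A cycle at `t` would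
enter through a preplace of `t`, which is produced by `σ`, and so would also force `t` into `σ`. -/
theorem History.not_causes {σ : List K.Trans} (hK : K.Backward) {t : K.Trans}
    (h : K.History (t :: σ)) {y : K.Trans} (hy : y ∈ t :: σ) : ¬ K.Causes (.inr t) (.inr y) := by
  intro hc
  rcases List.mem_cons.1 hy with rfl | hy
  · obtain ⟨z, hz, hzy⟩ := (Relation.TransGen.tail'_iff.1 hc)
    rcases z with p | z
    · have hp : p ∈ K.produced σ := h.2.2 hzy
      rcases Relation.reflTransGen_iff_eq_or_transGen.1 hz with hz | hz
      · simp at hz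
      · exact h.2.1 (h.1.closed hK hz hp)
    · exact hzy
  · exact h.2.1 (h.1.closed hK hc hy)

/-- Every cycle passes through a transition, and `History.not_causes` applies to the history cut off
at it. This replaces a direct check of acyclicity after a swap. -/
theorem History.acyclic {σ : List K.Trans} (h : K.History σ) (hK : K.Backward)
    (hσ : ∀ t, t ∈ σ) (x : K.Place ⊕ K.Trans) : ¬ K.Causes x x := by
  have key : ∀ τ, K.History τ → ∀ t ∈ τ, ¬ K.Causes (.inr t) (.inr t) := by
    intro τ hτ
    induction τ with
    | nil => simp
    | cons u τ ih =>
      intro t ht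
      rcases List.mem_cons.1 ht with rfl | ht'
      · exact hτ.not_causes hK ht
      · exact ih hτ.1 t ht'
  rcases x with p | t
  · intro hc
    obtain ⟨z, hz, hzp⟩ := (Relation.TransGen.head'_iff.1 hc)
    rcases z with q | z
    · exact hz
    · exact key σ h z (hσ z) (Relation.TransGen.tail' hzp hz)
  · exact key σ h t (hσ t)

/-- Places that are simultaneously marked are causally unrelated. -/
theorem History.not_causes_place {σ : List K.Trans} (h : K.History σ) (hK : K.Backward)
    {p q : K.Place} (hp : p ∉ K.consumed σ) (hq : q ∈ K.produced σ) :
    ¬ K.Causes (.inl p) (.inl q) := by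
  intro hc
  obtain ⟨z, hz, hzp⟩ := (Relation.TransGen.head'_iff.1 hc)
  rcases z with r | z
  · exact hz
  · rcases Relation.reflTransGen_iff_eq_or_transGen.1 hzp with hz' | hz'
    · simp at hz'
    · exact hp ⟨z, h.closed hK hz' hq, hz⟩

theorem causes_of_output_input {K : PetriNet.{u}} {t u : K.Trans} {p : K.Place}
    (ht : p ∈ K.outputs t) (hu : p ∈ K.inputs u) : K.Causes (.inr t) (.inr u) :=
  .head (show K.Flow (.inr t) (.inl p) from ht) (.single (show K.Flow (.inl p) (.inr u) from hu))

/-! ### Processes and their histories -/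

theorem GRProcess.backward (P : GRProcess N) : P.net.Backward where
  unmarked t p hp := P.valid.unmarked p fun h => ne_of_gt hp (h t)
  unique t t' p hp hp' := ((multisetCard_le_one_iff _).1 (P.valid.card_pre_le p)).2 t t' hp hp'

theorem GRProcess.consumer_unique (P : GRProcess N) {t t' : P.net.Trans} {p : P.net.Place}
    (h : p ∈ P.net.inputs t) (h' : p ∈ P.net.inputs t') : t = t' :=
  ((multisetCard_le_one_iff _).1 (P.valid.card_post_le p)).2 t t' h h'

theorem GRProcess.pre_le_one (P : GRProcess N) (p : P.net.Place) (t : P.net.Trans) :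
    P.net.pre p t ≤ 1 :=
  ((multisetCard_le_one_iff _).1 (P.valid.card_post_le p)).1 t

theorem GRProcess.post_le_one (P : GRProcess N) (t : P.net.Trans) (p : P.net.Place) :
    P.net.post t p ≤ 1 :=
  ((multisetCard_le_one_iff _).1 (P.valid.card_pre_le p)).1 t

theorem GRProcess.M₀_pos_iff (P : GRProcess N) (p : P.net.Place) :
    0 < P.net.M₀ p ↔ ∀ t, p ∉ P.net.outputs t := by
  constructor
  · intro h t ht
    exact h.ne' (P.backward.unmarked t p ht)
  · intro h
    rw [P.valid.marked p fun t => Nat.eq_zero_of_not_pos (h t)]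
    exact one_pos

theorem GRProcess.M₀_le_one (P : GRProcess N) (p : P.net.Place) : P.net.M₀ p ≤ 1 := by
  by_cases h : ∀ t, P.net.post t p = 0
  · exact (P.valid.marked p h).le
  · exact (P.valid.unmarked p h).le.trans zero_le_one

theorem GRProcess.encard_inputs (P : GRProcess N) (t : P.net.Trans) (s : N.Place) :
    (N.pre s (P.πT t) : ℕ∞) = {p | P.πS p = s ∧ p ∈ P.net.inputs t}.encard :=
  P.valid.map_pre t s

theorem GRProcess.encard_outputs (P : GRProcess N) (t : P.net.Trans) (s : N.Place) :
    (N.post (P.πT t) s : ℕ∞) = {p | P.πS p = s ∧ p ∈ P.net.outputs t}.encard :=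
  P.valid.map_post t s

theorem GRProcess.encard_initial (P : GRProcess N) (s : N.Place) :
    (N.M₀ s : ℕ∞) = {p | P.πS p = s ∧ p ∈ {p | 0 < P.net.M₀ p}}.encard :=
  P.valid.map_M₀ s

/-- The label of a preplace is a preplace of the label. -/
theorem GRProcess.pre_pos (P : GRProcess N) {t : P.net.Trans} {p : P.net.Place}
    (h : p ∈ P.net.inputs t) : 0 < N.pre (P.πS p) (P.πT t) := by
  have h1 := P.encard_inputs t (P.πS p)
  rw [pos_iff_ne_zero]
  intro h0
  rw [h0, Nat.cast_zero, eq_comm, Set.encard_eq_zero] at h1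
  exact Set.eq_empty_iff_forall_notMem.1 h1 p ⟨rfl, h⟩

theorem _root_.Set.encard_fiber_union {α β : Type*} {A B : Set α} (f : α → β) (c : β)
    (h : Disjoint A B) : {a | f a = c ∧ a ∈ A ∪ B}.encard =
      {a | f a = c ∧ a ∈ A}.encard + {a | f a = c ∧ a ∈ B}.encard := by
  rw [← Set.encard_union_eq]
  · congr 1
    ext a
    simp only [Set.mem_union, Set.mem_ofPred_eq]
    tauto
  · exact Set.disjoint_left.2 fun a ha hb => Set.disjoint_left.1 h ha.2 hb.2

/-- A place has at most one consumer, so the preplaces of distinct transitions are disjoint and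
their label counts add up. With `GRProcess.encard_produced`, this translates sets of places of the
process into token counts of the net. -/
theorem GRProcess.encard_consumed (P : GRProcess N) {σ : List P.net.Trans} (h : σ.Nodup)
    (s : N.Place) :
    (N.preset (σ.map P.πT : List N.Trans) s : ℕ∞) =
      {p | P.πS p = s ∧ p ∈ P.net.consumed σ}.encard := by
  induction σ with
  | nil =>
    simp [consumed]
  | cons t σ ih =>
    obtain ⟨ht, hσ⟩ := List.nodup_cons.1 h
    rw [consumed_cons, Set.encard_fiber_union, ← ih hσ, ← P.encard_inputs t s, List.map_cons,
      ← Multiset.cons_coe, preset_cons, Nat.cast_add]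
    exact Set.disjoint_left.2 fun p hp ⟨u, hu, hpu⟩ => ht (P.consumer_unique hp hpu ▸ hu)

theorem GRProcess.disjoint_produced (P : GRProcess N) {σ : List P.net.Trans} {t : P.net.Trans}
    (h : t ∉ σ) : Disjoint (P.net.produced σ) (P.net.outputs t) := by
  refine Set.disjoint_left.2 fun p hp hpt => ?_
  rcases hp with hp | ⟨u, hu, hpu⟩
  · exact hp.ne' (P.backward.unmarked t p hpt)
  · exact h (P.backward.unique _ _ p hpt hpu ▸ hu)

theorem GRProcess.encard_produced (P : GRProcess N) {σ : List P.net.Trans} (h : σ.Nodup)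
    (s : N.Place) :
    ((N.M₀ s + N.postset (σ.map P.πT : List N.Trans) s : ℕ) : ℕ∞) =
      {p | P.πS p = s ∧ p ∈ P.net.produced σ}.encard := by
  induction σ with
  | nil => simp [produced, P.encard_initial s]
  | cons t σ ih =>
    obtain ⟨ht, hσ⟩ := List.nodup_cons.1 h
    rw [produced_cons, Set.encard_fiber_union _ _ (P.disjoint_produced ht), ← ih hσ,
      ← P.encard_outputs t s, List.map_cons, ← Multiset.cons_coe, postset_cons]
    push_cast
    ring

theorem GRProcess.preset_le (P : GRProcess N) {σ τ : List P.net.Trans} (hσ : σ.Nodup)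
    (hτ : τ.Nodup) (h : P.net.consumed τ ⊆ P.net.produced σ) (s : N.Place) :
    N.preset (τ.map P.πT : List N.Trans) s ≤
      N.M₀ s + N.postset (σ.map P.πT : List N.Trans) s := by
  have h1 : {p | P.πS p = s ∧ p ∈ P.net.consumed τ} ⊆ {p | P.πS p = s ∧ p ∈ P.net.produced σ} :=
    fun p hp => ⟨hp.1, h hp.2⟩
  have h2 := Set.encard_le_encard h1
  rw [← P.encard_consumed hτ, ← P.encard_produced hσ] at h2
  exact_mod_cast h2

theorem History.fireable {P : GRProcess N} {σ : List P.net.Trans} (h : P.net.History σ) :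
    N.Fireable (σ.map P.πT) := by
  induction σ with
  | nil => trivial
  | cons t σ ih =>
    refine ⟨ih h.1, fun s => ?_⟩
    have := P.preset_le h.1.nodup h.nodup (by
      rw [consumed_cons]; exact Set.union_subset h.2.2 h.1.consumed_subset) s
    simpa using this

/-- A history within a finite causally closed set can be extended to the whole set. -/
theorem GRProcess.exists_history (P : GRProcess N) {D : Set P.net.Trans} (hD : D.Finite)
    (hc : ∀ t ∈ D, ∀ u, P.net.Causes (.inr u) (.inr t) → u ∈ D) {σ : List P.net.Trans}
    (h : P.net.History σ) (hσ : ∀ t ∈ σ, t ∈ D) :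
    ∃ τ, P.net.History (τ ++ σ) ∧ ∀ t, t ∈ τ ++ σ ↔ t ∈ D := by
  induction hn : (D \ {t | t ∈ σ}).ncard generalizing σ with
  | zero =>
    refine ⟨[], h, fun t => ⟨hσ t, fun ht => ?_⟩⟩
    rw [Set.ncard_eq_zero (hD.subset Set.sdiff_subset)] at hn
    by_contra hts
    exact Set.eq_empty_iff_forall_notMem.1 hn t ⟨ht, hts⟩
  | succ n ih =>
    have hf : (D \ {t | t ∈ σ}).Finite := hD.subset Set.sdiff_subset
    -- A missing transition with the fewest causes can come next: a missing producer of one of its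
    -- preplaces would have strictly fewer causes.
    obtain ⟨t, ⟨htD, htσ⟩, hmin⟩ := Set.exists_min_image _
      (fun t => {u | P.net.Causes (.inr u) (.inr t)}.ncard) hf
      (Set.nonempty_of_ncard_ne_zero (by omega))
    have h' : P.net.History (t :: σ) := by
      refine ⟨h, htσ, fun p hp => ?_⟩
      by_cases hp0 : 0 < P.net.M₀ p
      · exact Or.inl hp0
      · rw [P.M₀_pos_iff] at hp0
        push Not at hp0
        obtain ⟨u, hu⟩ := hp0
        refine Or.inr ⟨u, ?_, hu⟩
        have hut : P.net.Causes (.inr u) (.inr t) :=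
          causes_of_output_input hu hp
        by_contra huσ
        refine (hmin u ⟨hc t htD u hut, huσ⟩).not_gt
          (Set.ncard_lt_ncard ⟨fun v hv => hv.trans hut, fun hs => ?_⟩ (P.valid.finite_past t))
        exact P.valid.acyclic _ (hs hut)
    have hdiff : D \ {u | u ∈ t :: σ} = (D \ {u | u ∈ σ}) \ {t} := by
      ext u
      simp only [Set.mem_sdiff, Set.mem_ofPred_eq, List.mem_cons, Set.mem_singleton_iff]
      tauto
    obtain ⟨τ, hτ, hτD⟩ := ih h' (by simpa [htD] using hσ) (by
      rw [hdiff, Set.ncard_sdiff_singleton_of_mem (Set.mem_sdiff _ |>.2 ⟨htD, htσ⟩), hn]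
      rfl)
    exact ⟨τ ++ [t], by simpa using hτ, by simpa using hτD⟩

theorem GRProcess.finite_past_place (P : GRProcess N) (p : P.net.Place) :
    {u | P.net.Causes (.inr u) (.inl p)}.Finite := by
  by_cases h : ∃ t, p ∈ P.net.outputs t
  · obtain ⟨t, ht⟩ := h
    refine ((P.valid.finite_past t).insert t).subset fun u hu => ?_
    obtain ⟨z, hz, hzp⟩ := Relation.TransGen.tail'_iff.1 hu
    rcases z with q | z
    · exact hzp.elim
    · obtain rfl := P.backward.unique _ _ p ht hzp
      rcases Relation.reflTransGen_iff_eq_or_transGen.1 hz with hz | hz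
      · exact Or.inl (Sum.inr_injective hz.symm)
      · exact Or.inr hz
  · push Not at h
    convert Set.finite_empty
    refine Set.eq_empty_iff_forall_notMem.2 fun u hu => ?_
    obtain ⟨z, hz, hzp⟩ := Relation.TransGen.tail'_iff.1 hu
    rcases z with q | z
    · exact hzp
    · exact h z hzp

/-- There is a history of exactly the transitions in the past of one of two nodes. -/
theorem GRProcess.exists_history_past (P : GRProcess N) (x y : P.net.Place ⊕ P.net.Trans) :
    ∃ σ, P.net.History σ ∧
      ∀ t, t ∈ σ ↔ P.net.Causes (.inr t) x ∨ P.net.Causes (.inr t) y := by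
  have hfin : ∀ x, {u | P.net.Causes (.inr u) x}.Finite := by
    rintro (p | t)
    exacts [P.finite_past_place p, P.valid.finite_past t]
  obtain ⟨σ, h1, h2⟩ := P.exists_history (D := {t | P.net.Causes (.inr t) x} ∪
    {t | P.net.Causes (.inr t) y}) ((hfin x).union (hfin y))
    (fun t ht u hu => ht.imp hu.trans hu.trans) (σ := []) trivial (by simp)
  exact ⟨σ, by simpa using h1, by simpa using h2⟩

theorem GRProcess.mem_produced_of_past (P : GRProcess N) {p : P.net.Place}
    {σ : List P.net.Trans} (h : ∀ t, p ∈ P.net.outputs t → t ∈ σ) : p ∈ P.net.produced σ := by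
  by_cases hp0 : 0 < P.net.M₀ p
  · exact Or.inl hp0
  · rw [P.M₀_pos_iff] at hp0
    push Not at hp0
    obtain ⟨u, hu⟩ := hp0
    exact Or.inr ⟨u, h u hu, hu⟩

/-- In a structural conflict net, transitions of a process that consume from the same place of the
net are causally ordered. -/
theorem GRProcess.comparable (hN : N.IsStructuralConflictNet) (P : GRProcess N)
    {x y : P.net.Trans} {s : N.Place} (hx : 0 < N.pre s (P.πT x)) (hy : 0 < N.pre s (P.πT y))
    (hxy : x ≠ y) : P.net.Causes (.inr x) (.inr y) ∨ P.net.Causes (.inr y) (.inr x) := by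
  by_contra! hn
  -- Execute exactly the joint past. As `x` and `y` are unordered, neither belongs to it, so
  -- afterwards their disjoint presets are both marked.
  obtain ⟨σ, hσ, hm⟩ := P.exists_history_past (.inr x) (.inr y)
  have hxσ : x ∉ σ := fun h => ((hm x).1 h).elim (P.valid.acyclic _) hn.1
  have hyσ : y ∉ σ := fun h => ((hm y).1 h).elim hn.2 (P.valid.acyclic _)
  have hsub : P.net.consumed (x :: y :: σ) ⊆ P.net.produced σ := by
    rw [consumed_cons, consumed_cons]
    refine Set.union_subset ?_ (Set.union_subset ?_ hσ.consumed_subset) <;>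
      refine fun p hp => P.mem_produced_of_past fun t ht => (hm t).2 ?_
    · exact Or.inl (causes_of_output_input ht hp)
    · exact Or.inr (causes_of_output_input ht hp)
  have hle := P.preset_le hσ.nodup
    (List.nodup_cons.2 ⟨by simp [hxy, hxσ], List.nodup_cons.2 ⟨hyσ, hσ.nodup⟩⟩) hsub
  have h0 := hN (P.πT x) (P.πT y) _ _ hσ.fireable.reachable
    ⟨by simp, fun s => by
      have := hle s
      simp only [List.map_cons, ← Multiset.cons_coe, preset_cons, Multiset.insert_eq_cons,
        preset_singleton, marking] at this ⊢
      omega, fun s => rfl⟩ s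
  omega

/-! ### Traces -/

/-- The transitions in a word that consume from the place `s`. -/
def proj (N : PetriNet.{u}) (s : N.Place) (w : List N.Trans) : List N.Trans :=
  w.filter fun t => 0 < N.pre s t

theorem proj_append (s : N.Place) (v w : List N.Trans) :
    N.proj s (v ++ w) = N.proj s v ++ N.proj s w :=
  List.filter_append ..

theorem proj_cons_of_pos {s : N.Place} {t : N.Trans} (h : 0 < N.pre s t) (w : List N.Trans) :
    N.proj s (t :: w) = t :: N.proj s w := by
  simp [proj, h]

theorem proj_cons_of_not_pos {s : N.Place} {t : N.Trans} (h : ¬ 0 < N.pre s t)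
    (w : List N.Trans) : N.proj s (t :: w) = N.proj s w := by
  rw [proj, List.filter_cons_of_neg (by simpa using h)]
  rfl

theorem mem_proj {s : N.Place} {t : N.Trans} {w : List N.Trans} :
    t ∈ N.proj s w ↔ t ∈ w ∧ 0 < N.pre s t := by
  simp [proj]

theorem count_proj [DecidableEq N.Trans] {s : N.Place} {t : N.Trans} (h : 0 < N.pre s t)
    (w : List N.Trans) : (N.proj s w).count t = w.count t :=
  List.count_filter (by simpa using h)

theorem preset_proj (s : N.Place) (w : List N.Trans) :
    N.preset (N.proj s w : List N.Trans) s = N.preset (w : List N.Trans) s := by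
  induction w with
  | nil => rfl
  | cons t w ih =>
    by_cases h : 0 < N.pre s t
    · rw [proj_cons_of_pos h, ← Multiset.cons_coe, ← Multiset.cons_coe, preset_cons, preset_cons,
        ih]
    · rw [proj_cons_of_not_pos h, ← Multiset.cons_coe, preset_cons, ih]
      omega

theorem proj_suffix {v w : List N.Trans} (h : v <:+ w) (s : N.Place) :
    N.proj s v <:+ N.proj s w :=
  h.filter _

theorem History.pairwise {K : PetriNet.{u}} {σ : List K.Trans} (h : K.History σ)
    (hK : K.Backward) : σ.Pairwise fun t u => ¬ K.Causes (.inr t) (.inr u) := by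
  induction σ with
  | nil => exact List.Pairwise.nil
  | cons t σ ih =>
    exact List.pairwise_cons.2
      ⟨fun u hu => h.not_causes hK (List.mem_cons_of_mem _ hu), ih h.1⟩

/-- The transitions consuming from `s` are totally ordered by causality, and both histories respect
that order, so they list them identically. This makes the trace well defined. -/
theorem GRProcess.proj_eq_of_mem_iff (hN : N.IsStructuralConflictNet) (P : GRProcess N)
    {σ τ : List P.net.Trans} (hσ : P.net.History σ) (hτ : P.net.History τ)
    (h : ∀ t, t ∈ σ ↔ t ∈ τ) (s : N.Place) :
    N.proj s (σ.map P.πT) = N.proj s (τ.map P.πT) := by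
  simp only [proj, List.filter_map]
  congr 1
  refine List.Perm.eq_of_pairwise (le := fun t u => ¬ P.net.Causes (.inr t) (.inr u)) ?_
    ((hσ.pairwise P.backward).filter _) ((hτ.pairwise P.backward).filter _)
    (((List.perm_ext_iff_of_nodup hσ.nodup hτ.nodup).2 h).filter _)
  intro a b ha hb h1 h2
  by_contra hab
  simp only [List.mem_filter, Function.comp_apply, decide_eq_true_eq] at ha hb
  exact (P.comparable hN ha.2 hb.2 hab).elim h1 h2

/-- For each place `s` of the net, the sequence of transitions of the process that consume
from `s`. -/
noncomputable def GRProcess.trace (P : GRProcess N) (s : N.Place) : List N.Trans :=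
  N.proj s ((Classical.epsilon fun σ => P.net.History σ ∧ ∀ t, t ∈ σ).map P.πT)

/-- The full history `σ` guarantees that the choice in `trace` is meaningful; an infinite process
has no such list. -/
theorem GRProcess.trace_eq (hN : N.IsStructuralConflictNet) (P : GRProcess N)
    {σ : List P.net.Trans} (h : P.net.History σ) (hσ : ∀ t, t ∈ σ) (s : N.Place) :
    P.trace s = N.proj s (σ.map P.πT) := by
  have h1 := Classical.epsilon_spec (p := fun σ => P.net.History σ ∧ ∀ t, t ∈ σ) ⟨σ, h, hσ⟩
  exact P.proj_eq_of_mem_iff hN h1.1 h (fun t => by simp [h1.2, hσ]) s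

theorem GRProcess.IsFinite.exists_history {P : GRProcess N} (hP : P.IsFinite)
    {σ : List P.net.Trans} (h : P.net.History σ) :
    ∃ τ, P.net.History (τ ++ σ) ∧ ∀ t, t ∈ τ ++ σ := by
  have : Finite P.net.Trans := hP
  obtain ⟨τ, h1, h2⟩ := P.exists_history Set.finite_univ (fun _ _ _ _ => trivial) h (by simp)
  exact ⟨τ, h1, fun t => (h2 t).2 trivial⟩

theorem GRProcess.IsFinite.exists_full {P : GRProcess N} (hP : P.IsFinite) :
    ∃ σ, P.net.History σ ∧ ∀ t, t ∈ σ := by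
  obtain ⟨τ, h⟩ := hP.exists_history (σ := []) trivial
  exact ⟨_, h⟩

/-! ### Isomorphisms and prefixes -/

theorem MappedNet.Iso.history {P Q : MappedNet N} (e : P.Iso Q) {σ : List P.net.Trans}
    (h : P.net.History σ) : Q.net.History (σ.map e.φT) := by
  induction σ with
  | nil => trivial
  | cons t σ ih =>
    refine ⟨ih h.1, by simpa using h.2.1, fun q hq => ?_⟩
    obtain ⟨p, rfl⟩ := e.φS.surjective q
    have hp : p ∈ P.net.inputs t := by
      have : 0 < Q.net.pre (e.φS p) (e.φT t) := hq
      rwa [e.pre_eq] at this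
    rcases h.2.2 hp with h0 | ⟨u, hu, hpu⟩
    · exact Or.inl (by rwa [e.M₀_eq])
    · refine Or.inr ⟨e.φT u, List.mem_map_of_mem hu, ?_⟩
      change 0 < Q.net.post _ _
      rwa [e.post_eq]

/-- An embedding gives one inclusion only. Equality follows since both sides have the same finite
number of places of each label, dictated by the label of the transition. Thus the image of a prefix
is closed under causes. -/
theorem GRProcess.PrefixEmbedding.inputs_eq {P' P : GRProcess N} (f : P'.PrefixEmbedding P)
    (t : P'.net.Trans) : f.fS '' P'.net.inputs t = P.net.inputs (f.fT t) := by
  refine Set.eq_of_subset_of_encard_fiber_eq P.πS (fun s => N.pre s (P'.πT t)) (fun s => ?_)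
    (fun s => ?_) ?_
  · rw [P'.encard_inputs, ← f.fS.injective.encard_image]
    congr 1
    ext p
    constructor
    · rintro ⟨p, ⟨rfl, hp⟩, rfl⟩
      exact ⟨f.πS_eq p, p, hp, rfl⟩
    · rintro ⟨rfl, p, hp, rfl⟩
      exact ⟨p, ⟨(f.πS_eq p).symm, hp⟩, rfl⟩
  · rw [← f.πT_eq, P.encard_inputs]
  · rintro _ ⟨p, hp, rfl⟩
    change 0 < P.net.pre _ _
    rwa [f.pre_eq]

theorem GRProcess.PrefixEmbedding.history {P' P : GRProcess N} (f : P'.PrefixEmbedding P)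
    {σ : List P'.net.Trans} (h : P'.net.History σ) : P.net.History (σ.map f.fT) := by
  induction σ with
  | nil => trivial
  | cons t σ ih =>
    refine ⟨ih h.1, by simpa using h.2.1, ?_⟩
    rw [← f.inputs_eq]
    rintro _ ⟨p, hp, rfl⟩
    rcases h.2.2 hp with h0 | ⟨u, hu, hpu⟩
    · exact Or.inl (by rwa [f.M₀_eq])
    · refine Or.inr ⟨f.fT u, List.mem_map_of_mem hu, ?_⟩
      change 0 < P.net.post _ _
      rwa [f.post_eq]

theorem GRProcess.PrefixEmbedding.map_πT {P' P : GRProcess N} (f : P'.PrefixEmbedding P)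
    (σ : List P'.net.Trans) : (σ.map f.fT).map P.πT = σ.map P'.πT := by
  simp [f.πT_eq]

theorem GRProcess.PrefixEmbedding.trace_suffix (hN : N.IsStructuralConflictNet)
    {P Q : GRProcess N} (f : P.PrefixEmbedding Q) (hP : P.IsFinite) (hQ : Q.IsFinite)
    (s : N.Place) : P.trace s <:+ Q.trace s := by
  obtain ⟨σ, hσ, hf⟩ := hP.exists_full
  obtain ⟨τ, hτ, hg⟩ := hQ.exists_history (f.history hσ)
  rw [P.trace_eq hN hσ hf, Q.trace_eq hN hτ hg, List.map_append, f.map_πT]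
  exact proj_suffix (List.suffix_append ..) s

/-! ### Swapping -/

theorem inputs_swap (P : MappedNet N) {p q : P.net.Place} {t : P.net.Trans}
    (hp : p ∉ P.net.inputs t) (hq : q ∉ P.net.inputs t) :
    (P.swap p q).net.inputs t = P.net.inputs t := by
  classical
  refine Set.ext (α := P.net.Place) fun x => ?_
  change 0 < P.net.pre (Equiv.swap p q x) t ↔ 0 < P.net.pre x t
  by_cases hxp : x = p
  · subst hxp
    rw [Equiv.swap_apply_left]
    exact iff_of_false hq hp
  by_cases hxq : x = q
  · subst hxq
    rw [Equiv.swap_apply_right]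
    exact iff_of_false hp hq
  rw [Equiv.swap_apply_of_ne_of_ne hxp hxq]

theorem mem_inputs_swap (P : MappedNet N) (p q : P.net.Place) (t : P.net.Trans)
    {x : P.net.Place} (hxp : x ≠ p) (hxq : x ≠ q) :
    x ∈ (P.swap p q).net.inputs t ↔ x ∈ P.net.inputs t := by
  classical
  change 0 < P.net.pre (Equiv.swap p q x) t ↔ 0 < P.net.pre x t
  rw [Equiv.swap_apply_of_ne_of_ne hxp hxq]

theorem left_mem_inputs_swap (P : MappedNet N) (p q : P.net.Place) (t : P.net.Trans) :
    p ∈ (P.swap p q).net.inputs t ↔ q ∈ P.net.inputs t := by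
  classical
  change 0 < P.net.pre (Equiv.swap p q p) t ↔ 0 < P.net.pre q t
  rw [Equiv.swap_apply_left]

/-- Swapping two places that are simultaneously marked in a history keeps the history. -/
theorem History.swap {P : MappedNet N} {σ ρ : List P.net.Trans} (h : P.net.History ρ)
    (hσ : σ <:+ ρ) {p q : P.net.Place} (hp : p ∈ P.net.produced σ \ P.net.consumed σ)
    (hq : q ∈ P.net.produced σ \ P.net.consumed σ) :
    (P.swap p q).net.History ρ := by
  obtain ⟨τ, rfl⟩ := hσ
  -- Up to the moment at which `p` and `q` are both marked, neither has been consumed, so the swap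
  -- alters no preset. After that moment both are available, so exchanging their consumers does no
  -- harm.
  have h1 : ∀ σ : List P.net.Trans, P.net.History σ → p ∉ P.net.consumed σ →
      q ∉ P.net.consumed σ → (P.swap p q).net.History σ := by
    intro σ h hp hq
    induction σ with
    | nil => trivial
    | cons t σ ih =>
      rw [consumed_cons, Set.mem_union, not_or] at hp hq
      refine ⟨ih h.1 hp.2 hq.2, h.2.1, ?_⟩
      rw [inputs_swap P hp.1 hq.1]
      exact h.2.2
  induction τ with
  | nil => exact h1 σ h hp.2 hq.2
  | cons t τ ih =>
    refine ⟨ih h.1, h.2.1, fun x hx => ?_⟩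
    change x ∈ P.net.produced (τ ++ σ)
    have hsub : P.net.produced σ ⊆ P.net.produced (τ ++ σ) :=
      produced_mono (List.subset_append_right ..)
    by_cases hxp : x = p
    · exact hsub (hxp ▸ hp.1)
    by_cases hxq : x = q
    · exact hsub (hxq ▸ hq.1)
    exact h.2.2 ((mem_inputs_swap P p q t hxp hxq).1 hx)

/-- Equal labels of `p` and `q` preserve the label counts of presets, a full history of the swapped
net excludes cycles, and finiteness makes pasts finite. -/
theorem swap_valid (P : GRProcess N) {p q : P.net.Place} (hP : P.IsFinite)
    (hpq : P.πS p = P.πS q) {σ : List P.net.Trans}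
    (h : (P.toMappedNet.swap p q).net.History σ) (hσ : ∀ t, t ∈ σ) :
    IsGRProcess (P.toMappedNet.swap p q) where
  card_pre_le := P.valid.card_pre_le
  card_post_le s := P.valid.card_post_le _
  marked := P.valid.marked
  unmarked := P.valid.unmarked
  acyclic := h.acyclic ⟨P.backward.unmarked, P.backward.unique⟩ hσ
  finite_past v := by
    have : Finite P.net.Trans := hP
    exact Set.toFinite (α := P.net.Trans) _
  map_M₀ := P.valid.map_M₀
  map_pre t s := by
    classical
    refine (P.valid.map_pre t s).trans ?_
    rw [← (Equiv.swap p q).injective.encard_image]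
    congr 1
    have hπ : ∀ x, P.πS (Equiv.swap p q x) = P.πS x := by
      intro x
      by_cases hxp : x = p
      · rw [hxp, Equiv.swap_apply_left, hpq]
      by_cases hxq : x = q
      · rw [hxq, Equiv.swap_apply_right, hpq]
      rw [Equiv.swap_apply_of_ne_of_ne hxp hxq]
    ext x
    constructor
    · rintro ⟨y, ⟨rfl, hy⟩, rfl⟩
      exact ⟨hπ y, by change 0 < P.net.pre (Equiv.swap p q _) t; rwa [Equiv.swap_apply_self]⟩
    · rintro ⟨h1, h2⟩
      exact ⟨Equiv.swap p q x, ⟨(hπ x).trans h1, h2⟩, Equiv.swap_apply_self ..⟩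
  map_post := P.valid.map_post

theorem GRProcess.OneStepSwap.of_history (P : GRProcess N) {p q : P.net.Place}
    (hP : P.IsFinite) (hpq : P.πS p = P.πS q) {σ ρ : List P.net.Trans}
    (h : P.net.History ρ) (hσ : σ <:+ ρ) (hρ : ∀ t, t ∈ ρ)
    (hp : p ∈ P.net.produced σ \ P.net.consumed σ)
    (hq : q ∈ P.net.produced σ \ P.net.consumed σ) :
    P.OneStepSwap ⟨P.toMappedNet.swap p q, swap_valid P hP hpq (h.swap hσ hp hq) hρ⟩ := by
  obtain ⟨τ, rfl⟩ := hσ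
  have h' := h.of_append
  exact
  ⟨p, q, ⟨h'.not_causes_place P.backward hp.2 hq.1,
    h'.not_causes_place P.backward hq.2 hp.1, hpq⟩,
    ⟨⟨Equiv.refl _, Equiv.refl _, fun _ => rfl, fun _ _ => rfl, fun _ _ => rfl, fun _ => rfl,
      fun _ => rfl⟩⟩⟩

theorem MappedNet.Iso.trace_eq (hN : N.IsStructuralConflictNet) {P : MappedNet N}
    {Q : GRProcess N} (e : P.Iso Q.toMappedNet) {σ : List P.net.Trans} (h : P.net.History σ)
    (hσ : ∀ t, t ∈ σ) (s : N.Place) : Q.trace s = N.proj s (σ.map P.πT) := by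
  rw [Q.trace_eq hN (e.history h) fun t => by
    obtain ⟨t, rfl⟩ := e.φT.surjective t; exact List.mem_map_of_mem (hσ t)]
  congr 1
  rw [List.map_map]
  exact List.map_congr_left fun t _ => e.πT_eq t

theorem GRProcess.OneStepSwap.trace_eq (hN : N.IsStructuralConflictNet) {P Q : GRProcess N}
    (hP : P.IsFinite) (h : P.OneStepSwap Q) (s : N.Place) : Q.trace s = P.trace s := by
  obtain ⟨p, q, ⟨hpq, hqp, hπ⟩, ⟨e⟩⟩ := h
  -- After the joint past, `p` and `q` are both produced and, being causally unrelated, both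
  -- unconsumed. A full history through this point is a history before and after the swap, with the
  -- same labels.
  obtain ⟨σ, hσ, hm⟩ := P.exists_history_past (.inl p) (.inl q)
  obtain ⟨τ, hτ, hf⟩ := hP.exists_history hσ
  have hp : p ∈ P.net.produced σ \ P.net.consumed σ := by
    refine ⟨P.mem_produced_of_past fun t ht => (hm t).2 (Or.inl (.single ?_)), ?_⟩
    · exact ht
    · rintro ⟨t, ht, hpt⟩
      rcases (hm t).1 ht with h | h
      · exact P.valid.acyclic (.inl p) (.head (show P.net.Flow (.inl p) (.inr t) from hpt) h)
      · exact hpq (.head (show P.net.Flow (.inl p) (.inr t) from hpt) h)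
  have hq : q ∈ P.net.produced σ \ P.net.consumed σ := by
    refine ⟨P.mem_produced_of_past fun t ht => (hm t).2 (Or.inr (.single ?_)), ?_⟩
    · exact ht
    · rintro ⟨t, ht, hpt⟩
      rcases (hm t).1 ht with h | h
      · exact hqp (.head (show P.net.Flow (.inl q) (.inr t) from hpt) h)
      · exact P.valid.acyclic (.inl q) (.head (show P.net.Flow (.inl q) (.inr t) from hpt) h)
  rw [e.trace_eq hN (hτ.swap (List.suffix_append ..) hp hq) hf, P.trace_eq hN hτ hf]
  rfl

theorem GRProcess.SwapEquiv.finite_and_trace_eq (hN : N.IsStructuralConflictNet)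
    {P Q : GRProcess N} (h : P.SwapEquiv Q) (hP : P.IsFinite) :
    Q.IsFinite ∧ ∀ s, Q.trace s = P.trace s := by
  induction h with
  | refl => exact ⟨hP, fun _ => rfl⟩
  | @tail Q R _ h ih =>
    obtain ⟨hQ, ht⟩ := ih
    have : Finite Q.net.Trans := hQ
    rcases h with ⟨⟨e⟩⟩ | h
    · obtain ⟨σ, hσ, hf⟩ := hQ.exists_full
      refine ⟨Finite.of_equiv _ e.φT, fun s => ?_⟩
      rw [e.trace_eq hN hσ hf, ← ht, Q.trace_eq hN hσ hf]
    · refine ⟨?_, fun s => (h.trace_eq hN hQ s).trans (ht s)⟩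
      obtain ⟨p, q, -, ⟨e⟩⟩ := h
      exact Finite.of_equiv Q.net.Trans e.φT

/-! ### Restriction to a history -/

/-- The part of a process that consists of the transitions in a history. -/
abbrev GRProcess.restrictNet (P : GRProcess N) {σ : List P.net.Trans} (h : P.net.History σ) :
    MappedNet N where
  net :=
    { Place := {p // p ∈ P.net.produced σ}
      Trans := {t // t ∈ σ}
      pre := fun p t => P.net.pre p t
      post := fun t p => P.net.post t p
      M₀ := fun p => P.net.M₀ p
      pre_finite := fun t =>
        Set.Finite.preimage (f := Subtype.val) Subtype.val_injective.injOn (P.net.pre_finite t)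
      pre_nonempty := fun t =>
        let ⟨p, hp⟩ := P.net.pre_nonempty t
        ⟨⟨p, h.inputs_subset t.2 hp⟩, hp⟩
      post_finite := fun t =>
        Set.Finite.preimage (f := Subtype.val) Subtype.val_injective.injOn (P.net.post_finite t) }
  πS p := P.πS p
  πT t := P.πT t

theorem _root_.Set.encard_subtype_fiber {α β : Type*} {A B : Set α} (f : α → β) (c : β)
    (h : B ⊆ A) : {a : {a // a ∈ A} | f a = c ∧ a.1 ∈ B}.encard =
      {a | f a = c ∧ a ∈ B}.encard := by
  rw [← Subtype.val_injective.encard_image]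
  congr 1
  ext a
  constructor
  · rintro ⟨a, ha, rfl⟩
    exact ha
  · intro ha
    exact ⟨⟨a, h ha.2⟩, ha, rfl⟩

/-- A kept place without producer in `σ` must be initially marked. All preplaces and postplaces of
transitions in `σ` are kept, so label counts do not change. -/
theorem GRProcess.restrictNet_valid (P : GRProcess N) {σ : List P.net.Trans}
    (h : P.net.History σ) : IsGRProcess (P.restrictNet h) where
  card_pre_le p := (multisetCard_le_one_iff _).2 ⟨fun t => P.post_le_one t p,
    fun t t' ht ht' => Subtype.ext (P.backward.unique _ _ p.1 ht ht')⟩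
  card_post_le p := (multisetCard_le_one_iff _).2 ⟨fun t => P.pre_le_one p t,
    fun t t' ht ht' => Subtype.ext (P.consumer_unique (p := p.1) ht ht')⟩
  marked p hp := by
    rcases p.2 with h0 | ⟨t, ht, hpt⟩
    · exact le_antisymm (P.M₀_le_one p) h0
    · exact absurd (hp ⟨t, ht⟩) (ne_of_gt hpt)
  unmarked p hp := by
    push Not at hp
    obtain ⟨t, ht⟩ := hp
    exact P.backward.unmarked t.1 p.1 (Nat.pos_of_ne_zero ht)
  acyclic x hx := by
    refine P.valid.acyclic (Sum.map Subtype.val Subtype.val x)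
      (Relation.TransGen.lift (Sum.map Subtype.val Subtype.val) ?_ _ _ hx)
    rintro (a | a) (b | b) hab
    exacts [hab, hab, hab, hab]
  finite_past t :=
    have : Finite {t // t ∈ σ} := σ.finite_toSet.to_subtype
    Set.toFinite (α := {t // t ∈ σ}) _
  map_M₀ s := (P.encard_initial s).trans
    (Set.encard_subtype_fiber (B := {p | 0 < P.net.M₀ p}) P.πS s fun p hp => Or.inl hp).symm
  map_pre t s := (P.encard_inputs t s).trans
    (Set.encard_subtype_fiber P.πS s (h.inputs_subset t.2)).symm
  map_post t s := (P.encard_outputs t s).trans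
    (Set.encard_subtype_fiber P.πS s fun _ hp => Or.inr ⟨t.1, t.2, hp⟩).symm

/-- The part of a process that consists of the transitions in a history, as a process. -/
abbrev GRProcess.restrict (P : GRProcess N) {σ : List P.net.Trans} (h : P.net.History σ) :
    GRProcess N :=
  ⟨P.restrictNet h, P.restrictNet_valid h⟩

theorem GRProcess.restrict_finite (P : GRProcess N) {σ : List P.net.Trans}
    (h : P.net.History σ) : (P.restrict h).IsFinite :=
  σ.finite_toSet.to_subtype

/-- The inclusion of a restriction. -/
def GRProcess.restrictEmbedding (P : GRProcess N) {σ : List P.net.Trans} (h : P.net.History σ) :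
    (P.restrict h).PrefixEmbedding P where
  fS := Function.Embedding.subtype _
  fT := Function.Embedding.subtype _
  M₀_eq _ := rfl
  M₀_outside p hp := Nat.eq_zero_of_not_pos fun h0 => hp ⟨⟨p, Or.inl h0⟩, rfl⟩
  pre_eq _ _ := rfl
  post_eq _ _ := rfl
  πS_eq _ := rfl
  πT_eq _ := rfl

theorem GRProcess.trace_restrict (hN : N.IsStructuralConflictNet) (P : GRProcess N)
    {σ : List P.net.Trans} (h : P.net.History σ) (s : N.Place) :
    (P.restrict h).trace s = N.proj s (σ.map P.πT) := by
  obtain ⟨τ, hτ, hf⟩ := (P.restrict_finite h).exists_full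
  rw [trace_eq hN _ hτ hf, ← (P.restrictEmbedding h).map_πT]
  refine P.proj_eq_of_mem_iff hN ((P.restrictEmbedding h).history hτ) h (fun t => ?_) s
  constructor
  · intro ht
    obtain ⟨u, -, rfl⟩ := List.mem_map.1 ht
    exact u.2
  · intro ht
    exact List.mem_map.2 ⟨⟨t, ht⟩, hf _, rfl⟩

/-! ### Partial embeddings -/

/-- The maps `gS` and `gT` embed the part of `P` that belongs to the history `σ` into `Q`. -/
structure PartialEmbedding (P Q : GRProcess N) (σ : List P.net.Trans)
    (gS : P.net.Place → Q.net.Place) (gT : P.net.Trans → Q.net.Trans) : Prop where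
  injS : Set.InjOn gS (P.net.produced σ)
  injT : Set.InjOn gT {t | t ∈ σ}
  initial : gS '' {p | 0 < P.net.M₀ p} = {p | 0 < Q.net.M₀ p}
  inputs : ∀ t ∈ σ, gS '' P.net.inputs t = Q.net.inputs (gT t)
  outputs : ∀ t ∈ σ, gS '' P.net.outputs t = Q.net.outputs (gT t)
  πS : ∀ p ∈ P.net.produced σ, Q.πS (gS p) = P.πS p
  πT : ∀ t ∈ σ, Q.πT (gT t) = P.πT t

namespace PartialEmbedding

variable {P Q : GRProcess N} {σ : List P.net.Trans} {gS : P.net.Place → Q.net.Place}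
  {gT : P.net.Trans → Q.net.Trans}

theorem tail {t : P.net.Trans} (h : PartialEmbedding P Q (t :: σ) gS gT) :
    PartialEmbedding P Q σ gS gT where
  injS := h.injS.mono (produced_mono (List.subset_cons_self ..))
  injT := h.injT.mono fun _ hu => List.mem_cons_of_mem _ hu
  initial := h.initial
  inputs u hu := h.inputs u (List.mem_cons_of_mem _ hu)
  outputs u hu := h.outputs u (List.mem_cons_of_mem _ hu)
  πS p hp := h.πS p (produced_mono (List.subset_cons_self ..) hp)
  πT u hu := h.πT u (List.mem_cons_of_mem _ hu)

theorem image_produced (h : PartialEmbedding P Q σ gS gT) :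
    gS '' P.net.produced σ = Q.net.produced (σ.map gT) := by
  induction σ with
  | nil => simpa [produced] using h.initial
  | cons t σ ih =>
    rw [List.map_cons, produced_cons, produced_cons, Set.image_union, ih h.tail,
      h.outputs t List.mem_cons_self]

theorem image_consumed (h : PartialEmbedding P Q σ gS gT) :
    gS '' P.net.consumed σ = Q.net.consumed (σ.map gT) := by
  induction σ with
  | nil => simp [consumed]
  | cons t σ ih =>
    rw [List.map_cons, consumed_cons, consumed_cons, Set.image_union, ih h.tail,
      h.inputs t List.mem_cons_self]

theorem map_πT (h : PartialEmbedding P Q σ gS gT) :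
    (σ.map gT).map Q.πT = σ.map P.πT := by
  rw [List.map_map]
  exact List.map_congr_left fun t ht => h.πT t ht

theorem history (h : PartialEmbedding P Q σ gS gT) (hσ : P.net.History σ) :
    Q.net.History (σ.map gT) := by
  induction σ with
  | nil => trivial
  | cons t σ ih =>
    refine ⟨ih h.tail hσ.1, ?_, ?_⟩
    · intro ht
      obtain ⟨u, hu, hut⟩ := List.mem_map.1 ht
      obtain rfl := h.injT (List.mem_cons_of_mem _ hu) (List.mem_cons_self (l := σ)) hut
      exact hσ.2.1 hu
    · rw [← h.inputs t List.mem_cons_self, ← h.tail.image_produced]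
      exact Set.image_mono hσ.2.2

/-- Both initial markings have `N.M₀ s` places over each `s`, so they can be matched by label. The
remaining work is to see that total maps exist at all. -/
theorem empty (P Q : GRProcess N) {σ : List P.net.Trans} (hσ : P.net.History σ)
    (hf : ∀ t, t ∈ σ) [Nonempty (P.net.Trans → Q.net.Trans)] :
    ∃ (gS : P.net.Place → Q.net.Place) (gT : P.net.Trans → Q.net.Trans),
      PartialEmbedding P Q [] gS gT := by
  have hQ : Nonempty P.net.Place → Nonempty Q.net.Place := by
    rintro ⟨p⟩
    have hp : ∃ p, 0 < P.net.M₀ p := by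
      -- Without transitions every place is initial; otherwise the earliest transition, at the end
      -- of the list, has an initially marked preplace.
      rcases σ.eq_nil_or_concat with rfl | ⟨τ, t, rfl⟩
      · exact ⟨p, (P.M₀_pos_iff p).2 fun t => absurd (hf t) List.not_mem_nil⟩
      · obtain ⟨q, hq⟩ := P.net.pre_nonempty t
        rcases (History.of_append (σ := [t]) (by simpa using hσ)).2.2 hq with h | ⟨u, hu, -⟩
        · exact ⟨q, h⟩
        · exact absurd hu List.not_mem_nil
    obtain ⟨p, hp⟩ := hp
    have h1 : {x | P.πS x = P.πS p ∧ x ∈ {x | 0 < P.net.M₀ x}}.encard ≠ 0 := by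
      rw [Set.encard_ne_zero]
      exact ⟨p, rfl, hp⟩
    rw [← P.encard_initial, Q.encard_initial, Set.encard_ne_zero] at h1
    exact ⟨h1.some⟩
  obtain ⟨gT⟩ := ‹Nonempty (P.net.Trans → Q.net.Trans)›
  obtain ⟨gS, h1, h2⟩ : ∃ gS : P.net.Place → Q.net.Place,
      Set.BijOn gS {p | 0 < P.net.M₀ p} {p | 0 < Q.net.M₀ p} ∧
      ∀ p ∈ {p | 0 < P.net.M₀ p}, Q.πS (gS p) = P.πS p := by
    rcases isEmpty_or_nonempty P.net.Place with h | h
    · have hq : ∀ q, ¬ 0 < Q.net.M₀ q := by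
        intro q hq
        have h1 : {x | Q.πS x = Q.πS q ∧ x ∈ {x | 0 < Q.net.M₀ x}}.encard ≠ 0 := by
          rw [Set.encard_ne_zero]
          exact ⟨q, rfl, hq⟩
        rw [← Q.encard_initial, P.encard_initial, Set.encard_ne_zero] at h1
        exact h.elim h1.some
      exact ⟨h.elim, ⟨fun p => h.elim p, fun p => h.elim p, fun q h => absurd h (hq q)⟩,
        fun p => h.elim p⟩
    · have := hQ h
      exact Set.exists_bijOn_of_encard_fiber_eq _ _ P.πS Q.πS N.M₀ P.encard_initial
        Q.encard_initial
  have h3 : P.net.produced [] = {p | 0 < P.net.M₀ p} := by simp [produced]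
  exact ⟨gS, gT, by rw [h3]; exact h1.injOn, by simp, h1.image_eq, by simp, by simp,
    by rw [h3]; exact h2, by simp⟩

/-- Only the postplaces of `t` need new images. They match those of `x` label by label, and
injectivity survives because both sets of postplaces are disjoint from what was produced before. -/
theorem extend (h : PartialEmbedding P Q σ gS gT) {t : P.net.Trans}
    (ht : P.net.History (t :: σ)) {x : Q.net.Trans} (hx : x ∉ σ.map gT)
    (hπ : Q.πT x = P.πT t) (hin : gS '' P.net.inputs t = Q.net.inputs x) :
    ∃ gS' gT', PartialEmbedding P Q (t :: σ) gS' gT' := by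
  classical
  have hne : Nonempty Q.net.Place := ⟨(Q.net.pre_nonempty x).some⟩
  obtain ⟨β, hβ, hβπ⟩ := Set.exists_bijOn_of_encard_fiber_eq _ _ P.πS Q.πS (N.post (P.πT t))
    (P.encard_outputs t) (hπ ▸ Q.encard_outputs x)
  have hd := Set.disjoint_left.1 (P.disjoint_produced ht.2.1)
  have hd' := Set.disjoint_left.1 (Q.disjoint_produced hx)
  let gS' : P.net.Place → Q.net.Place := fun p => if p ∈ P.net.outputs t then β p else gS p
  have e1 : ∀ p ∈ P.net.produced σ, gS' p = gS p := fun p hp => if_neg (hd hp)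
  have e2 : ∀ p ∈ P.net.outputs t, gS' p = β p := fun p hp => if_pos hp
  have e3 : ∀ u ∈ σ, Function.update gT t x u = gT u := fun u hu =>
    Function.update_of_ne (fun (h : u = t) => ht.2.1 (h ▸ hu)) _ _
  have e4 : ∀ A ⊆ P.net.produced σ, gS' '' A = gS '' A := fun A hA =>
    Set.image_congr fun p hp => e1 p (hA hp)
  have e5 : gS' '' P.net.outputs t = Q.net.outputs x := by
    rw [← hβ.image_eq]
    exact Set.image_congr e2
  refine ⟨gS', Function.update gT t x, ?_, ?_, ?_, ?_, ?_, ?_, ?_⟩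
  · rw [produced_cons]
    refine (Set.injOn_union (P.disjoint_produced ht.2.1)).2
      ⟨h.injS.congr fun p hp => (e1 p hp).symm, hβ.injOn.congr fun p hp => (e2 p hp).symm, ?_⟩
    intro p hp q hq hpq
    have h1 : gS' p ∈ Q.net.produced (σ.map gT) := by
      rw [e1 p hp, ← h.image_produced]
      exact Set.mem_image_of_mem _ hp
    exact hd' h1 (hpq ▸ e5 ▸ Set.mem_image_of_mem _ hq)
  · have hnot : ∀ u ∈ σ, gT u ≠ x := fun u hu hux => hx (hux ▸ List.mem_map_of_mem hu)
    intro u hu v hv huv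
    rcases List.mem_cons.1 hu with rfl | hu' <;> rcases List.mem_cons.1 hv with rfl | hv'
    · rfl
    · rw [Function.update_self, e3 v hv'] at huv
      exact absurd huv.symm (hnot v hv')
    · rw [Function.update_self, e3 u hu'] at huv
      exact absurd huv (hnot u hu')
    · rw [e3 u hu', e3 v hv'] at huv
      exact h.injT hu' hv' huv
  · rw [e4 {p | 0 < P.net.M₀ p} fun p hp => Or.inl hp, h.initial]
  · intro u hu
    rcases List.mem_cons.1 hu with rfl | hu
    · rw [Function.update_self, e4 _ ht.2.2, hin]
    · rw [e3 u hu, e4 _ (ht.1.inputs_subset hu), h.inputs u hu]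
  · intro u hu
    rcases List.mem_cons.1 hu with rfl | hu
    · rw [Function.update_self, e5]
    · rw [e3 u hu, e4 (P.net.outputs u) fun p hp => Or.inr ⟨u, hu, hp⟩, h.outputs u hu]
  · intro p hp
    rw [produced_cons] at hp
    rcases hp with hp | hp
    · rw [e1 p hp, h.πS p hp]
    · rw [e2 p hp, hβπ p hp]
  · intro u hu
    rcases List.mem_cons.1 hu with rfl | hu
    · rw [Function.update_self, hπ]
    · rw [e3 u hu, h.πT u hu]

/-- Arc weights and initial markings of processes are at most one, so equality of the supporting
sets gives equality of numbers. -/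
theorem toPrefix (h : PartialEmbedding P Q σ gS gT) (hf : ∀ t, t ∈ σ) : P.Prefix Q := by
  have hprod : ∀ p, p ∈ P.net.produced σ := fun p => P.mem_produced_of_past fun t _ => hf t
  have hS : Function.Injective gS := fun p q hpq => h.injS (hprod p) (hprod q) hpq
  have hT : Function.Injective gT := fun p q hpq => h.injT (hf p) (hf q) hpq
  have key : ∀ {a b : ℕ}, a ≤ 1 → b ≤ 1 → (0 < a ↔ 0 < b) → a = b := by omega
  refine ⟨⟨gS, hS⟩, ⟨gT, hT⟩, fun p => ?_, fun q hq => ?_, fun p t => ?_, fun t p => ?_,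
    fun p => h.πS p (hprod p), fun t => h.πT t (hf t)⟩
  · refine key (Q.M₀_le_one _) (P.M₀_le_one _) ?_
    change gS p ∈ {p | 0 < Q.net.M₀ p} ↔ p ∈ {p | 0 < P.net.M₀ p}
    rw [← h.initial, hS.mem_set_image]
  · refine Nat.eq_zero_of_not_pos fun h0 => hq ?_
    have h1 : q ∈ {p | 0 < Q.net.M₀ p} := h0
    rw [← h.initial] at h1
    exact ⟨h1.choose, h1.choose_spec.2⟩
  · refine key (Q.pre_le_one _ _) (P.pre_le_one _ _) ?_
    change gS p ∈ Q.net.inputs (gT t) ↔ p ∈ P.net.inputs t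
    rw [← h.inputs t (hf t), hS.mem_set_image]
  · refine key (Q.post_le_one _ _) (P.post_le_one _ _) ?_
    change gS p ∈ Q.net.outputs (gT t) ↔ p ∈ P.net.outputs t
    rw [← h.outputs t (hf t), hS.mem_set_image]

end PartialEmbedding

end PetriNet

/-! ### Realising an inclusion of traces by swapping -/

theorem List.exists_split_last {α : Type*} (p : α → Prop) (l : List α) (h : ∃ x ∈ l, p x) :
    ∃ K x G, l = K ++ x :: G ∧ p x ∧ ∀ y ∈ G, ¬ p y := by
  induction l with
  | nil => simp at h
  | cons a l ih =>
    by_cases hl : ∃ x ∈ l, p x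
    · obtain ⟨K, x, G, rfl, hx, hG⟩ := ih hl
      exact ⟨a :: K, x, G, rfl, hx, hG⟩
    · push Not at hl
      obtain ⟨x, hx, hpx⟩ := h
      rcases List.mem_cons.1 hx with rfl | hx
      · exact ⟨[], x, l, rfl, hpx, hl⟩
      · exact absurd hpx (hl x hx)

namespace PetriNet

variable {N : PetriNet.{u}}

/-- If the next transition of `P` occurs in `Q` after transitions that do not compete with it for
preplaces, then swapping makes its preplaces match, and the embedding can be extended. -/
theorem PartialEmbedding.exists_extend {P : GRProcess N} {σ : List P.net.Trans} {t : P.net.Trans}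
    (ht : P.net.History (t :: σ)) (n : ℕ) : ∀ (Q : GRProcess N) (gS : P.net.Place → Q.net.Place)
    (gT : P.net.Trans → Q.net.Trans) (K G : List Q.net.Trans) (x : Q.net.Trans),
    Q.IsFinite → PartialEmbedding P Q σ gS gT → (gS '' P.net.inputs t \ Q.net.inputs x).ncard = n →
    Q.net.History (K ++ x :: (G ++ σ.map gT)) → (∀ u, u ∈ K ++ x :: (G ++ σ.map gT)) →
    Q.πT x = P.πT t →
    (∀ y ∈ G, ∀ s, 0 < N.pre s (P.πT t) → ¬ 0 < N.pre s (Q.πT y)) →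
    ∃ Q', Q.SwapEquiv Q' ∧ ∃ gS gT, PartialEmbedding P Q' (t :: σ) gS gT := by
  induction n with
  | zero =>
    intro Q gS gT K G x hQ h hn hv hf hπ hG
    have hx : x ∉ σ.map gT := fun hx =>
      (History.of_append hv).2.1 (List.mem_append_right _ hx)
    have hfin : (gS '' P.net.inputs t).Finite := (P.net.pre_finite t).image _
    rw [Set.ncard_eq_zero (hfin.subset Set.sdiff_subset), Set.sdiff_eq_empty] at hn
    refine ⟨Q, .refl, h.extend ht hx hπ
      (Set.eq_of_subset_of_encard_fiber_eq Q.πS (fun s => N.pre s (P.πT t)) (fun s => ?_)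
        (fun s => hπ ▸ Q.encard_inputs x s) hn)⟩
    rw [P.encard_inputs, ← (h.injS.mono fun p hp => ht.2.2 hp.2).encard_image]
    congr 1
    ext p
    constructor
    · rintro ⟨p, ⟨rfl, hp⟩, rfl⟩
      exact ⟨h.πS p (ht.2.2 hp), p, hp, rfl⟩
    · rintro ⟨rfl, p, hp, rfl⟩
      exact ⟨p, ⟨(h.πS p (ht.2.2 hp)).symm, hp⟩, rfl⟩
  | succ n ih =>
    intro Q gS gT K G x hQ h hn hv hf hπ hG
    have hfin : (gS '' P.net.inputs t).Finite := (P.net.pre_finite t).image _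
    have hA : ∀ s, (N.pre s (P.πT t) : ℕ∞) =
        {p | Q.πS p = s ∧ p ∈ gS '' P.net.inputs t}.encard := by
      intro s
      rw [P.encard_inputs, ← (h.injS.mono fun p hp => ht.2.2 hp.2).encard_image]
      congr 1
      ext p
      constructor
      · rintro ⟨p, ⟨rfl, hp⟩, rfl⟩
        exact ⟨h.πS p (ht.2.2 hp), p, hp, rfl⟩
      · rintro ⟨rfl, p, hp, rfl⟩
        exact ⟨p, ⟨(h.πS p (ht.2.2 hp)).symm, hp⟩, rfl⟩
    have hx := History.of_append hv
    -- At the moment just before `x`, the places that `x` should consume are still marked, since `G`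
    -- does not compete for their labels. The places that `x` does consume are marked too, so any
    -- two of these places are swappable if their labels agree.
    have hcutA : gS '' P.net.inputs t ⊆
        Q.net.produced (G ++ σ.map gT) \ Q.net.consumed (G ++ σ.map gT) := by
      rintro _ ⟨p, hp, rfl⟩
      refine ⟨produced_mono (List.subset_append_right ..) ?_, ?_⟩
      · rw [← h.image_produced]
        exact ⟨p, ht.2.2 hp, rfl⟩
      · rintro ⟨y, hy, hpy⟩
        rcases List.mem_append.1 hy with hy | hy
        · refine hG y hy (P.πS p) (P.pre_pos hp) ?_
          rw [← h.πS p (ht.2.2 hp)]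
          exact Q.pre_pos hpy
        · have h1 : gS p ∈ Q.net.consumed (σ.map gT) := ⟨y, hy, hpy⟩
          rw [← h.image_consumed] at h1
          obtain ⟨q, hq, hqp⟩ := h1
          obtain rfl := h.injS (ht.1.consumed_subset hq) (ht.2.2 hp) hqp
          obtain ⟨u, hu, hqu⟩ := hq
          exact ht.2.1 (P.consumer_unique hqu hp ▸ hu)
    have hcutB : Q.net.inputs x ⊆
        Q.net.produced (G ++ σ.map gT) \ Q.net.consumed (G ++ σ.map gT) := fun q hq =>
      ⟨hx.2.2 hq, fun ⟨u, hu, hqu⟩ => hx.2.1 (Q.consumer_unique hqu hq ▸ hu)⟩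
    obtain ⟨p, hpA, hpB⟩ := Set.nonempty_of_ncard_ne_zero (hn.trans_ne n.succ_ne_zero)
    -- Both sets have equally many places of each label, so a wanted place `p` that `x` misses is
    -- balanced by an unwanted `q` with the same label. Swapping them lowers the number of missed
    -- places by one.
    obtain ⟨q, hqB, hqA, hpq⟩ : ∃ q ∈ Q.net.inputs x, q ∉ gS '' P.net.inputs t ∧
        Q.πS p = Q.πS q := by
      by_contra! hno
      have hsub : {b | Q.πS b = Q.πS p ∧ b ∈ Q.net.inputs x} ⊆
          {b | Q.πS b = Q.πS p ∧ b ∈ gS '' P.net.inputs t} := fun b hb =>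
        ⟨hb.1, by_contra fun hbA => hno b hb.2 hbA hb.1.symm⟩
      have heq := (Set.finite_of_encard_eq_coe
        (Q.encard_inputs x (Q.πS p)).symm).eq_of_subset_of_encard_le hsub
        (by rw [← hA, ← Q.encard_inputs, hπ])
      have h2 : p ∈ {b | Q.πS b = Q.πS p ∧ b ∈ gS '' P.net.inputs t} := ⟨rfl, hpA⟩
      rw [← heq] at h2
      exact hpB h2.2
    have hp := hcutA hpA
    have hq := hcutB hqB
    have hsuf : G ++ σ.map gT <:+ K ++ x :: (G ++ σ.map gT) :=
      (List.suffix_cons ..).trans (List.suffix_append ..)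
    have hstep := GRProcess.OneStepSwap.of_history Q hQ hpq hv hsuf hf hp hq
    have hin : ∀ y ∈ G ++ σ.map gT,
        (Q.toMappedNet.swap p q).net.inputs y = Q.net.inputs y := fun y hy =>
      inputs_swap _ (fun h => hp.2 ⟨y, hy, h⟩) fun h => hq.2 ⟨y, hy, h⟩
    obtain ⟨Q', hQ', hg⟩ := ih ⟨Q.toMappedNet.swap p q, swap_valid Q hQ hpq (hv.swap hsuf hp hq) hf⟩
      gS gT K G x hQ
      { injS := h.injS
        injT := h.injT
        initial := h.initial
        inputs := fun u hu => (h.inputs u hu).trans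
          (hin _ (List.mem_append_right _ (List.mem_map_of_mem hu))).symm
        outputs := h.outputs
        πS := h.πS
        πT := h.πT }
      (by
        have hd : gS '' P.net.inputs t \ (Q.toMappedNet.swap p q).net.inputs x =
            (gS '' P.net.inputs t \ Q.net.inputs x) \ {p} := by
          refine Set.ext (α := Q.net.Place) fun y => ?_
          constructor
          · rintro ⟨hyA, hyB⟩
            have hyp : y ≠ p := fun hyp =>
              hyB (hyp ▸ (left_mem_inputs_swap Q.toMappedNet p q x).2 hqB)
            have hyq : y ≠ q := fun hyq => hqA (hyq ▸ hyA)
            exact ⟨⟨hyA, fun hy => hyB ((mem_inputs_swap Q.toMappedNet p q x hyp hyq).2 hy)⟩, hyp⟩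
          · rintro ⟨⟨hyA, hyB⟩, hyp⟩
            have hyq : y ≠ q := fun hyq => hqA (hyq ▸ hyA)
            exact ⟨hyA, fun hy => hyB ((mem_inputs_swap Q.toMappedNet p q x hyp hyq).1 hy)⟩
        refine (congrArg Set.ncard hd).trans ?_
        rw [Set.ncard_sdiff_singleton_of_mem (Set.mem_sdiff _ |>.2 ⟨hpA, hpB⟩), hn]
        rfl)
      (hv.swap hsuf hp hq) hf hπ hG
    exact ⟨Q', .head (Or.inr hstep) hQ', hg⟩

/-- The embedding grows along a history of `P`, while `Q` is replaced by swapping equivalent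
processes; their traces stay the same, so the hypothesis on traces persists. -/
theorem GRProcess.exists_partialEmbedding (hN : N.IsStructuralConflictNet) {P Q : GRProcess N}
    (hQ : Q.IsFinite) (h : ∀ s, P.trace s <:+ Q.trace s)
    {σ : List P.net.Trans} (hσ : P.net.History σ) (hf : ∀ t, t ∈ σ) (ρ : List P.net.Trans)
    (hρ : ρ <:+ σ) : ∃ Q', Q.SwapEquiv Q' ∧ ∃ gS gT, PartialEmbedding P Q' ρ gS gT := by
  induction ρ with
  | nil =>
    obtain ⟨τ, hτ, hg⟩ := hQ.exists_full
    have hne : ∀ t : P.net.Trans, Nonempty Q.net.Trans := by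
      intro t
      obtain ⟨p, hp⟩ := P.net.pre_nonempty t
      have h1 : P.πT t ∈ P.trace (P.πS p) := by
        rw [P.trace_eq hN hσ hf, mem_proj]
        exact ⟨List.mem_map_of_mem (hf t), P.pre_pos hp⟩
      have h2 := (h _).subset h1
      rw [Q.trace_eq hN hτ hg, mem_proj] at h2
      obtain ⟨u, -⟩ := List.mem_map.1 h2.1
      exact ⟨u⟩
    have : Nonempty (P.net.Trans → Q.net.Trans) := ⟨fun t => (hne t).some⟩
    exact ⟨Q, .refl, PartialEmbedding.empty P Q hσ hf⟩
  | cons t ρ ih =>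
    obtain ⟨Q', hQ', gS, gT, hg⟩ := ih ((List.suffix_cons t ρ).trans hρ)
    obtain ⟨hfin, htr⟩ := hQ'.finite_and_trace_eq hN hQ
    obtain ⟨π, hπ⟩ := hρ
    have ht : P.net.History (t :: ρ) := History.of_append (hπ ▸ hσ)
    obtain ⟨κ, hκ, hκf⟩ := hfin.exists_history (hg.history ht.1)
    -- At each preplace of its label, `t` is the next consumer in the trace. So the first label
    -- consuming from `s` after the part already embedded is that of `t`.
    have hlast : ∀ s, 0 < N.pre s (P.πT t) →
        ∃ a, N.proj s (κ.map Q'.πT) = a ++ [P.πT t] := by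
      intro s hs
      have h1 : N.proj s ((t :: ρ).map P.πT) <:+ Q'.trace s := by
        rw [htr]
        refine .trans ?_ (h s)
        rw [P.trace_eq hN hσ hf, ← hπ, List.map_append]
        exact proj_suffix (List.suffix_append ..) s
      rw [Q'.trace_eq hN hκ hκf, List.map_append, hg.map_πT, proj_append, List.map_cons,
        proj_cons_of_pos hs] at h1
      obtain ⟨a, ha⟩ := h1
      exact ⟨a, (List.append_cancel_right (by rw [← ha]; simp)).symm⟩
    -- Take `x` to be the earliest remaining occurrence of this label, the last one in the reversed
    -- list. A competitor in `G` would be preceded by, or be, a still earlier occurrence.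
    obtain ⟨K, x, G, rfl, hx, hG⟩ := List.exists_split_last (fun x => Q'.πT x = P.πT t) κ (by
      obtain ⟨p, hp⟩ := P.net.pre_nonempty t
      obtain ⟨a, ha⟩ := hlast _ (P.pre_pos hp)
      have h1 : P.πT t ∈ N.proj (P.πS p) (κ.map Q'.πT) := by simp [ha]
      exact List.mem_map.1 (mem_proj.1 h1).1)
    obtain ⟨Q'', hQ'', hext⟩ := PartialEmbedding.exists_extend ht _ Q' gS gT K G x hfin hg rfl
      (by simpa using hκ) (by simpa using hκf) hx (fun y hy s hs hys => by
        obtain ⟨a, ha⟩ := hlast s hs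
        rw [List.map_append, List.map_cons, hx, proj_append, proj_cons_of_pos hs] at ha
        have hyG : Q'.πT y ∈ N.proj s (G.map Q'.πT) :=
          mem_proj.2 ⟨List.mem_map_of_mem hy, hys⟩
        rcases (N.proj s (G.map Q'.πT)).eq_nil_or_concat with h0 | ⟨b, z, hz⟩
        · simp [h0] at hyG
        · rw [hz, List.append_cons, List.concat_eq_append, ← List.append_assoc] at ha
          obtain rfl : z = P.πT t := by simpa using (List.append_inj' ha rfl).2
          have h1 : P.πT t ∈ N.proj s (G.map Q'.πT) := by simp [hz]
          obtain ⟨u, hu, hut⟩ := List.mem_map.1 (mem_proj.1 h1).1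
          exact hG u hu hut)
    exact ⟨Q'', hQ'.trans hQ'', hext⟩

/-- The prefix relation on finite BD-processes, in terms of traces. -/
theorem finiteBD_prefix_iff (hN : N.IsStructuralConflictNet) {P Q : GRProcess N}
    (hP : P.IsFinite) (hQ : Q.IsFinite) :
    (P.finiteBD hP).Prefix (Q.finiteBD hQ) ↔ ∀ s, P.trace s <:+ Q.trace s := by
  constructor
  · rintro ⟨P', Q', hP', hQ', h1, h2, ⟨f⟩⟩ s
    have h3 : P'.SwapEquiv P := Quotient.exact h1
    have h4 : Q'.SwapEquiv Q := Quotient.exact h2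
    rw [(h3.finite_and_trace_eq hN hP').2, (h4.finite_and_trace_eq hN hQ').2]
    exact f.trace_suffix hN hP' hQ' s
  · intro h
    obtain ⟨σ, hσ, hf⟩ := hP.exists_full
    obtain ⟨Q', hQ', gS, gT, hg⟩ :=
      GRProcess.exists_partialEmbedding hN hQ h hσ hf σ List.suffix_rfl
    have hfin := (hQ'.finite_and_trace_eq hN hQ).1
    refine ⟨P, Q', hP, hfin, rfl, ?_, hg.toPrefix hf⟩
    exact (Quotient.sound hQ' : Q.finiteBD hQ = Q'.finiteBD hfin).symm

/-! ### The BD-run of a process -/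

theorem FiniteBDProcess.exists_rep (c : FiniteBDProcess N) :
    ∃ (Q : GRProcess N) (hQ : Q.IsFinite), Q.finiteBD hQ = c := by
  obtain ⟨⟨Q, hQ⟩, rfl⟩ := Quotient.exists_rep c
  exact ⟨Q, hQ, rfl⟩

theorem GRProcess.mem_BD_iff (hN : N.IsStructuralConflictNet) (P : GRProcess N) {Q : GRProcess N}
    (hQ : Q.IsFinite) : Q.finiteBD hQ ∈ P.BD ↔
      ∃ σ, P.net.History σ ∧ ∀ s, Q.trace s <:+ N.proj s (σ.map P.πT) := by
  constructor
  · rintro ⟨P', hP', ⟨f⟩, h⟩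
    obtain ⟨τ, hτ, hf⟩ := hP'.exists_full
    refine ⟨τ.map f.fT, f.history hτ, fun s => ?_⟩
    rw [f.map_πT, ← P'.trace_eq hN hτ hf]
    exact (finiteBD_prefix_iff hN hQ hP').1 h s
  · rintro ⟨σ, hσ, h⟩
    refine ⟨P.restrict hσ, P.restrict_finite hσ, ⟨P.restrictEmbedding hσ⟩,
      (finiteBD_prefix_iff hN hQ _).2 fun s => ?_⟩
    rw [P.trace_restrict hN]
    exact h s

/-- Two histories can be extended to histories of the same transitions. -/
theorem GRProcess.exists_common_history (P : GRProcess N) {σ τ : List P.net.Trans}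
    (hσ : P.net.History σ) (hτ : P.net.History τ) :
    ∃ σ' τ', P.net.History (σ' ++ σ) ∧ P.net.History (τ' ++ τ) ∧
      ∀ t, t ∈ σ' ++ σ ↔ t ∈ τ' ++ τ := by
  have hD : {t | t ∈ σ ∨ t ∈ τ}.Finite := σ.finite_toSet.union τ.finite_toSet
  have hc : ∀ t ∈ {t | t ∈ σ ∨ t ∈ τ}, ∀ u, P.net.Causes (.inr u) (.inr t) →
      u ∈ {t | t ∈ σ ∨ t ∈ τ} := fun t ht u hu =>
    ht.imp (fun ht => hσ.closed P.backward hu ht) fun ht => hτ.closed P.backward hu ht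
  obtain ⟨σ', h1, h2⟩ := P.exists_history hD hc hσ fun _ => Or.inl
  obtain ⟨τ', h3, h4⟩ := P.exists_history hD hc hτ fun _ => Or.inr
  exact ⟨σ', τ', h1, h3, fun t => (h2 t).trans (h4 t).symm⟩

theorem GRProcess.isBDRun_BD (hN : N.IsStructuralConflictNet) (P : GRProcess N) :
    IsBDRun P.BD where
  nonempty := by
    have h : P.net.History [] := trivial
    refine ⟨(P.restrict h).finiteBD (P.restrict_finite h), (P.mem_BD_iff hN _).2 ⟨[], h, ?_⟩⟩
    intro s
    rw [P.trace_restrict hN]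
  prefix_closed c d hcd hd := by
    obtain ⟨Q, hQ, rfl⟩ := c.exists_rep
    obtain ⟨R, hR, rfl⟩ := d.exists_rep
    rw [finiteBD_prefix_iff hN] at hcd
    rw [P.mem_BD_iff hN] at hd ⊢
    obtain ⟨σ, hσ, h⟩ := hd
    exact ⟨σ, hσ, fun s => (hcd s).trans (h s)⟩
  directed c hc d hd := by
    obtain ⟨Q, hQ, rfl⟩ := c.exists_rep
    obtain ⟨R, hR, rfl⟩ := d.exists_rep
    rw [P.mem_BD_iff hN] at hc hd
    obtain ⟨σ, hσ, h1⟩ := hc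
    obtain ⟨τ, hτ, h2⟩ := hd
    obtain ⟨σ', τ', hσ', hτ', hm⟩ := P.exists_common_history hσ hτ
    have hle : ∀ (v w : List P.net.Trans) s,
        N.proj s (w.map P.πT) <:+ N.proj s ((v ++ w).map P.πT) := fun v w s => by
      rw [List.map_append]
      exact proj_suffix (List.suffix_append ..) s
    refine ⟨(P.restrict hσ').finiteBD (P.restrict_finite hσ'),
      (P.mem_BD_iff hN _).2 ⟨_, hσ', fun s => ?_⟩, (finiteBD_prefix_iff hN _ _).2 fun s => ?_,
      (finiteBD_prefix_iff hN _ _).2 fun s => ?_⟩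
    · rw [P.trace_restrict hN]
    · rw [P.trace_restrict hN]
      exact (h1 s).trans (hle _ _ s)
    -- The two extended histories contain the same transitions, so one of them can replace the other
    -- in every projection.
    · rw [P.trace_restrict hN, P.proj_eq_of_mem_iff hN hσ' hτ' hm]
      exact (h2 s).trans (hle _ _ s)

/-! ### Adding a transition to a process -/

open Classical in
/-- Add an occurrence of the transition `t` that consumes the places in `A`. -/
noncomputable abbrev GRProcess.addNet (P : GRProcess N) (t : N.Trans) (A : Set P.net.Place)
    (hA : A.Finite) (hA' : A.Nonempty) : MappedNet N where
  net :=
    { Place := P.net.Place ⊕ Σ s, Fin (N.post t s)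
      Trans := Option P.net.Trans
      pre := fun
        | .inl p, some u => P.net.pre p u
        | .inl p, none => if p ∈ A then 1 else 0
        | .inr _, _ => 0
      post := fun
        | some u, .inl p => P.net.post u p
        | none, .inr _ => 1
        | _, _ => 0
      M₀ := Sum.elim P.net.M₀ fun _ => 0
      pre_finite := by
        rintro (_ | u)
        · refine (hA.image Sum.inl).subset ?_
          rintro (p | x) hp
          · exact ⟨p, by by_contra h; simp [h] at hp, rfl⟩
          · exact absurd hp (lt_irrefl 0)
        · refine ((P.net.pre_finite u).image Sum.inl).subset ?_
          rintro (p | x) hp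
          · exact ⟨p, hp, rfl⟩
          · exact absurd hp (lt_irrefl 0)
      pre_nonempty := by
        rintro (_ | u)
        · exact hA'.elim fun p hp => ⟨.inl p, by simp [hp]⟩
        · exact (P.net.pre_nonempty u).elim fun p hp => ⟨.inl p, hp⟩
      post_finite := by
        rintro (_ | u)
        · have hf : {x : Σ s, Fin (N.post t s) | True}.Finite := by
            refine ((N.post_finite t).biUnion fun s _ =>
              Set.finite_range (Sigma.mk (β := fun s => Fin (N.post t s)) s)).subset fun x _ => ?_
            exact Set.mem_biUnion (x := x.1) x.2.pos ⟨x.2, rfl⟩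
          refine (hf.image Sum.inr).subset ?_
          rintro (p | x) hp
          · exact absurd hp (lt_irrefl 0)
          · exact ⟨x, trivial, rfl⟩
        · refine ((P.net.post_finite u).image Sum.inl).subset ?_
          rintro (p | x) hp
          · exact ⟨p, hp, rfl⟩
          · exact absurd hp (lt_irrefl 0) }
  πS := Sum.elim P.πS Sigma.fst
  πT u := u.elim t P.πT

section Add

variable {P : GRProcess N} {t : N.Trans} {A : Set P.net.Place} {hA : A.Finite} {hA' : A.Nonempty}

/-- The nodes of the original process among those of the extension. -/
def GRProcess.addEmb (P : GRProcess N) (t : N.Trans) (x : P.net.Place ⊕ P.net.Trans) :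
    (P.net.Place ⊕ Σ s, Fin (N.post t s)) ⊕ Option P.net.Trans :=
  Sum.map Sum.inl some x

/-- The new transition leads only to new places, and these have no outgoing arcs. Hence adding it
creates no new causes of old nodes. -/
theorem GRProcess.addNet_flow {x : (P.net.Place ⊕ Σ s, Fin (N.post t s)) ⊕ Option P.net.Trans}
    {y : P.net.Place ⊕ P.net.Trans}
    (h : (P.addNet t A hA hA').net.Flow x (P.addEmb t y)) :
    ∃ x', x = P.addEmb t x' ∧ P.net.Flow x' y := by
  rcases x with (p | z) | (_ | u) <;> rcases y with q | v
  · exact h.elim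
  · exact ⟨.inl p, rfl, h⟩
  · exact h.elim
  · exact absurd h (lt_irrefl 0)
  · exact absurd h (lt_irrefl 0)
  · exact h.elim
  · exact ⟨.inr u, rfl, h⟩
  · exact h.elim

theorem GRProcess.addNet_causes
    {x : (P.net.Place ⊕ Σ s, Fin (N.post t s)) ⊕ Option P.net.Trans}
    {y : P.net.Place ⊕ P.net.Trans}
    (h : (P.addNet t A hA hA').net.Causes x (P.addEmb t y)) :
    ∃ x', x = P.addEmb t x' ∧ P.net.Causes x' y := by
  induction h using Relation.TransGen.head_induction_on with
  | single h =>
    obtain ⟨x', rfl, h1⟩ := addNet_flow h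
    exact ⟨x', rfl, .single h1⟩
  | head h _ ih =>
    obtain ⟨y', rfl, h'⟩ := ih
    obtain ⟨x', rfl, h1⟩ := addNet_flow h
    exact ⟨x', rfl, .head h1 h'⟩

theorem GRProcess.addNet_causes_new
    {x : (P.net.Place ⊕ Σ s, Fin (N.post t s)) ⊕ Option P.net.Trans}
    (h : (P.addNet t A hA hA').net.Causes x (.inr none)) :
    ∃ p ∈ A, x = .inl (.inl p) ∨ ∃ x', x = P.addEmb t x' ∧ P.net.Causes x' (.inl p) := by
  obtain ⟨z, hz, hzt⟩ := Relation.TransGen.tail'_iff.1 h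
  rcases z with (p | z) | z
  · have hp : p ∈ A := by
      by_contra hp
      classical
      have h1 : 0 < (if p ∈ A then 1 else 0) := hzt
      simp [hp] at h1
    refine ⟨p, hp, ?_⟩
    rcases Relation.reflTransGen_iff_eq_or_transGen.1 hz with hz | hz
    · exact Or.inl hz.symm
    · exact Or.inr (addNet_causes (y := .inl p) hz)
  · exact absurd hzt (lt_irrefl 0)
  · exact hzt.elim

/-- That the places in `A` are unconsumed keeps consumers unique; their label counts make the preset
of the new transition the right one. -/
theorem GRProcess.addNet_valid (hA₁ : ∀ p ∈ A, ∀ u, p ∉ P.net.inputs u)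
    (hA₂ : ∀ s, (N.pre s t : ℕ∞) = {p | P.πS p = s ∧ p ∈ A}.encard) :
    IsGRProcess (P.addNet t A hA hA') where
  card_pre_le := by
    rintro (p | x)
    · refine (multisetCard_le_one_iff _).2 ⟨?_, ?_⟩
      · rintro (_ | u)
        · exact zero_le_one
        · exact P.post_le_one u p
      · rintro (_ | u) (_ | v) hu hv
        · rfl
        · exact absurd hu (lt_irrefl 0)
        · exact absurd hv (lt_irrefl 0)
        · exact congrArg some (P.backward.unique u v p hu hv)
    · refine (multisetCard_le_one_iff _).2 ⟨?_, ?_⟩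
      · rintro (_ | u)
        · exact le_rfl
        · exact zero_le_one
      · rintro (_ | u) (_ | v) hu hv
        · rfl
        · exact absurd hv (lt_irrefl 0)
        · exact absurd hu (lt_irrefl 0)
        · exact absurd hu (lt_irrefl 0)
  card_post_le := by
    classical
    have hmem : ∀ p, 0 < (if p ∈ A then 1 else 0) → p ∈ A := fun p hp => by
      by_contra h
      simp [h] at hp
    rintro (p | x)
    · refine (multisetCard_le_one_iff _).2 ⟨?_, ?_⟩
      · rintro (_ | u)
        · change (if p ∈ A then 1 else 0) ≤ 1
          split <;> simp
        · exact P.pre_le_one p u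
      · rintro (_ | u) (_ | v) hu hv
        · rfl
        · exact absurd hv (hA₁ p (hmem p (by convert hu)) v)
        · exact absurd hu (hA₁ p (hmem p (by convert hv)) u)
        · exact congrArg some (P.consumer_unique (p := p) hu hv)
    · exact (multisetCard_le_one_iff _).2
        ⟨fun _ => zero_le_one, fun _ _ hu => absurd hu (lt_irrefl 0)⟩
  marked := by
    rintro (p | x) h
    · exact P.valid.marked p fun u => h (some u)
    · exact absurd (h none) one_ne_zero
  unmarked := by
    rintro (p | x) h
    · refine P.valid.unmarked p fun h' => h ?_
      rintro (_ | u)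
      exacts [rfl, h' u]
    · rfl
  acyclic := by
    have hold : ∀ y, ¬ (P.addNet t A hA hA').net.Causes (P.addEmb t y) (P.addEmb t y) := by
      intro y hy
      obtain ⟨x, hx, h⟩ := addNet_causes hy
      have hinj : Function.Injective (P.addEmb t) :=
        Sum.map_injective.2 ⟨Sum.inl_injective, Option.some_injective _⟩
      exact P.valid.acyclic _ (hinj hx ▸ h)
    rintro ((p | z) | (_ | u)) h
    · exact hold (.inl p) h
    · obtain ⟨w, hw, -⟩ := Relation.TransGen.head'_iff.1 h
      rcases w with w | w
      · exact hw
      · exact lt_irrefl 0 hw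
    · obtain ⟨p, -, h | ⟨x, hx, -⟩⟩ := addNet_causes_new h
      · cases h
      · rcases x with x | x <;> cases hx
    · exact hold (.inr u) h
  finite_past := by
    rintro (_ | u)
    · refine ((hA.biUnion fun p _ => P.finite_past_place p).image some).subset fun v hv => ?_
      obtain ⟨p, hp, h | ⟨x, hx, h⟩⟩ := addNet_causes_new hv
      · cases h
      · rcases x with x | x
        · cases hx
        · cases hx
          exact ⟨x, Set.mem_biUnion hp h, rfl⟩
    · refine ((P.valid.finite_past u).image some).subset fun v hv => ?_
      obtain ⟨x, hx, h⟩ := addNet_causes (y := .inr u) hv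
      rcases x with x | x
      · cases hx
      · cases hx
        exact ⟨x, h, rfl⟩
  map_M₀ s := by
    rw [P.encard_initial, ← Sum.inl_injective.encard_image]
    congr 1
    ext x
    constructor
    · rintro ⟨p, hp, rfl⟩
      exact hp
    · rcases x with p | x
      · exact fun hp => ⟨p, hp, rfl⟩
      · exact fun hp => absurd hp.2 (lt_irrefl 0)
  map_pre := by
    rintro (_ | u) s
    · refine (hA₂ s).trans ?_
      rw [← Sum.inl_injective.encard_image]
      congr 1
      ext x
      constructor
      · rintro ⟨p, hp, rfl⟩
        exact ⟨hp.1, by simp [hp.2]⟩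
      · rcases x with p | x
        · exact fun hp => ⟨p, ⟨hp.1, by by_contra h; simp [h] at hp⟩, rfl⟩
        · exact fun hp => absurd hp.2 (lt_irrefl 0)
    · refine (P.encard_inputs u s).trans ?_
      rw [← Sum.inl_injective.encard_image]
      congr 1
      ext x
      constructor
      · rintro ⟨p, hp, rfl⟩
        exact hp
      · rcases x with p | x
        · exact fun hp => ⟨p, hp, rfl⟩
        · exact fun hp => absurd hp.2 (lt_irrefl 0)
  map_post := by
    rintro (_ | u) s
    · have h1 : (Set.univ : Set (Fin (N.post t s))).encard = N.post t s := by simp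
      refine h1.symm.trans ?_
      have hinj : Function.Injective fun i : Fin (N.post t s) =>
          (Sum.inr ⟨s, i⟩ : P.net.Place ⊕ Σ s, Fin (N.post t s)) := fun i j hij => by
        simpa using hij
      rw [← hinj.encard_image]
      congr 1
      ext x
      constructor
      · rintro ⟨i, -, rfl⟩
        exact ⟨rfl, one_pos⟩
      · rcases x with p | ⟨s', i⟩
        · exact fun hp => absurd hp.2 (lt_irrefl 0)
        · rintro ⟨rfl, -⟩
          exact ⟨i, trivial, rfl⟩
    · refine (P.encard_outputs u s).trans ?_
      rw [← Sum.inl_injective.encard_image]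
      congr 1
      ext x
      constructor
      · rintro ⟨p, hp, rfl⟩
        exact hp
      · rcases x with p | x
        · exact fun hp => ⟨p, hp, rfl⟩
        · exact fun hp => absurd hp.2 (lt_irrefl 0)

end Add

/-- A process that leaves unconsumed all that a transition needs is not maximal. -/
theorem GRProcess.not_isMaximal_of_unconsumed (P : GRProcess N) (t : N.Trans)
    (h : ∀ s, (N.pre s t : ℕ∞) ≤ {p | P.πS p = s ∧ ∀ u, p ∉ P.net.inputs u}.encard) :
    ¬ P.IsMaximal := by
  -- There may be infinitely many unconsumed places, so exactly as many as `t` needs are selected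
  -- over each `s`.
  choose B hB hBc using fun s => Set.exists_subset_encard_eq (h s)
  let A : Set P.net.Place := {p | p ∈ B (P.πS p)}
  have hfib : ∀ s, {p | P.πS p = s ∧ p ∈ A} = B s := by
    intro s
    ext p
    constructor
    · rintro ⟨rfl, hp⟩
      exact hp
    · intro hp
      obtain rfl := (hB s hp).1
      exact ⟨rfl, hp⟩
  have hA₂ : ∀ s, (N.pre s t : ℕ∞) = {p | P.πS p = s ∧ p ∈ A}.encard := fun s => by
    rw [hfib, hBc]
  have hA : A.Finite := by
    refine ((N.pre_finite t).biUnion fun s _ =>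
      Set.finite_of_encard_eq_coe (hBc s)).subset fun p hp => ?_
    refine Set.mem_biUnion (x := P.πS p) (Nat.pos_of_ne_zero fun h0 => ?_) hp
    have := hBc (P.πS p)
    rw [h0, Nat.cast_zero, Set.encard_eq_zero] at this
    exact Set.eq_empty_iff_forall_notMem.1 this p hp
  have hA' : A.Nonempty := by
    obtain ⟨s, hs⟩ := N.pre_nonempty t
    have : (B s).Nonempty := by
      rw [← Set.encard_ne_zero, hBc]
      exact_mod_cast ne_of_gt hs
    obtain ⟨p, hp⟩ := this
    rw [← hfib] at hp
    exact ⟨p, hp.2⟩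
  refine not_not.2 ⟨⟨P.addNet t A hA hA', addNet_valid (fun p hp => (hB _ hp).2) hA₂⟩,
    ⟨⟨Sum.inl, Sum.inl_injective⟩, ⟨some, Option.some_injective _⟩, fun _ => rfl, ?_,
      fun _ _ => rfl, fun _ _ => rfl, fun _ => rfl, fun _ => rfl⟩, fun hs => ?_⟩
  · rintro (p | x) hp
    · exact absurd ⟨p, rfl⟩ hp
    · rfl
  · obtain ⟨u, hu⟩ := hs.2 none
    cases hu

end PetriNet

/-! ### Maximal processes have maximal BD-runs -/

theorem List.exists_suffix_of_not {α : Type*} (p : List α → Prop) (h0 : p []) (l : List α)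
    (hl : ¬ p l) : ∃ t ρ, t :: ρ <:+ l ∧ p ρ ∧ ¬ p (t :: ρ) := by
  induction l with
  | nil => exact absurd h0 hl
  | cons t l ih =>
    by_cases h : p l
    · exact ⟨t, l, List.suffix_rfl, h, hl⟩
    · obtain ⟨u, ρ, h1, h2⟩ := ih h
      exact ⟨u, ρ, h1.trans (List.suffix_cons t l), h2⟩

namespace PetriNet

variable {N : PetriNet.{u}}

/-- If every projection of `w` is a suffix of the one of `v`, then `v` contains `w` as a
multiset. -/
theorem coe_le_coe_of_proj_suffix {v w : List N.Trans}
    (h : ∀ s, N.proj s w <:+ N.proj s v) : (w : Multiset N.Trans) ≤ v := by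
  classical
  refine Multiset.le_iff_count.2 fun u => ?_
  obtain ⟨s, hs⟩ := N.pre_nonempty u
  rw [Multiset.coe_count, Multiset.coe_count, ← count_proj hs w, ← count_proj hs v]
  exact (h s).sublist.count_le u

/-- Even in an infinite process `u` has a finite past, so a history ending in `u` exists and can be
merged with `τ`. -/
theorem GRProcess.exists_history_mem (P : GRProcess N) {τ : List P.net.Trans}
    (hτ : P.net.History τ) (u : P.net.Trans) : ∃ κ, P.net.History (κ ++ τ) ∧ u ∈ κ ++ τ := by
  obtain ⟨σ, hσ, hm⟩ := P.exists_history_past (.inr u) (.inr u)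
  have hu : P.net.History (u :: σ) :=
    ⟨hσ, fun h => ((hm u).1 h).elim (P.valid.acyclic _) (P.valid.acyclic _), fun p hp =>
      P.mem_produced_of_past fun t ht => (hm t).2 (Or.inl (causes_of_output_input ht hp))⟩
  obtain ⟨κ, κ', h1, -, h2⟩ := P.exists_common_history hτ hu
  exact ⟨κ, h1, (h2 u).2 (List.mem_append_right _ List.mem_cons_self)⟩

/-- Suppose that `t` can be fired after `α`, that `α` has been executed in the history `τ`, and
that nothing else in the process consumes from the preplaces of `t`. Then the process is not
maximal. -/
theorem GRProcess.not_isMaximal_of_history (P : GRProcess N) {τ : List P.net.Trans}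
    (hτ : P.net.History τ) {t : N.Trans} {α : List N.Trans} (hα : N.Fireable (t :: α))
    (hle : ∀ s, N.proj s α <:+ N.proj s (τ.map P.πT))
    (heq : ∀ κ, P.net.History (κ ++ τ) → ∀ s, 0 < N.pre s t →
      N.proj s ((κ ++ τ).map P.πT) = N.proj s α) : ¬ P.IsMaximal := by
  -- A competitor outside `τ` could be reached by extending `τ`, which would lengthen a projection
  -- that is not allowed to change.
  have hmem : ∀ s, 0 < N.pre s t → ∀ u, 0 < N.pre s (P.πT u) → u ∈ τ := by
    intro s hs u hu
    obtain ⟨κ, hκ, huκ⟩ := P.exists_history_mem hτ u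
    rcases List.mem_append.1 huκ with huκ | huτ
    · have h1 := heq κ hκ s hs
      rw [← heq [] hτ s hs, List.map_append, proj_append, List.nil_append,
        List.append_left_eq_self] at h1
      have h2 : P.πT u ∈ N.proj s (κ.map P.πT) := mem_proj.2 ⟨List.mem_map_of_mem huκ, hu⟩
      simp [h1] at h2
    · exact huτ
  refine P.not_isMaximal_of_unconsumed t fun s => ?_
  rcases Nat.eq_zero_or_pos (N.pre s t) with h0 | hs
  · simp [h0]
  -- Over a preplace of `t`, whatever `τ` produces is consumed within `τ` or never. There `τ`
  -- consumes as much as `α` and produces at least as much, so the tokens that enable `t` after `α`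
  -- are left over.
  have hsub : {p | P.πS p = s ∧ p ∈ P.net.produced τ} ⊆
      {p | P.πS p = s ∧ p ∈ P.net.consumed τ} ∪
        {p | P.πS p = s ∧ ∀ u, p ∉ P.net.inputs u} := by
    rintro p ⟨rfl, -⟩
    by_cases hp : ∃ u, p ∈ P.net.inputs u
    · obtain ⟨u, hu⟩ := hp
      exact Or.inl ⟨rfl, u, hmem _ hs u (P.pre_pos hu), hu⟩
    · exact Or.inr ⟨rfl, not_exists.1 hp⟩
  have h1 := (Set.encard_le_encard hsub).trans (Set.encard_union_le _ _)
  rw [← P.encard_produced hτ.nodup, ← P.encard_consumed hτ.nodup] at h1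
  have h2 := hα.2 s
  have h3 := N.postset_mono (coe_le_coe_of_proj_suffix hle) s
  have h4 : N.preset (α : Multiset N.Trans) s = N.preset (τ.map P.πT : List N.Trans) s := by
    rw [← preset_proj, ← heq [] hτ s hs, List.nil_append, preset_proj]
  rw [preset_cons] at h2
  generalize {p | P.πS p = s ∧ ∀ u, p ∉ P.net.inputs u}.encard = n at h1
  induction n using ENat.recTopCoe with
  | top => exact le_top
  | coe n =>
    norm_cast at h1 ⊢
    omega

theorem GRProcess.IsMaximal.isMaximalBDRun (hN : N.IsStructuralConflictNet) {P : GRProcess N}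
    (hP : P.IsMaximal) : IsMaximalBDRun P.BD := by
  classical
  refine ⟨P.isBDRun_BD hN, fun R hR hsub => Set.Subset.antisymm (fun c hc => ?_) hsub⟩
  by_contra hcP
  obtain ⟨Q, hQ, rfl⟩ := c.exists_rep
  obtain ⟨σ, hσ, hf⟩ := hQ.exists_full
  rw [P.mem_BD_iff hN] at hcP
  simp only [Q.trace_eq hN hσ hf] at hcP
  -- The first transition of the outside member whose execution is no longer covered by a history of
  -- `P`.
  obtain ⟨t, α, hα, ⟨τ, hτ, hle⟩, hno⟩ := List.exists_suffix_of_not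
    (fun ρ => ∃ τ, P.net.History τ ∧
      ∀ s, N.proj s (ρ.map Q.πT) <:+ N.proj s (τ.map P.πT))
    ⟨[], trivial, fun _ => List.suffix_rfl⟩ σ hcP
  -- Directedness of `R` gives an upper bound of this history and the outside member. At each place
  -- both traces are suffixes of its trace, hence comparable.
  have hcompat : ∀ H, P.net.History H → ∀ s,
      N.proj s (H.map P.πT) <:+ N.proj s (σ.map Q.πT) ∨
        N.proj s (σ.map Q.πT) <:+ N.proj s (H.map P.πT) := by
    intro H hH s
    obtain ⟨e, -, he1, he2⟩ := hR.directed _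
      (hsub ((P.mem_BD_iff hN (P.restrict_finite hH)).2 ⟨H, hH, fun s => by
        rw [P.trace_restrict hN]⟩)) _ hc
    obtain ⟨E, hE, rfl⟩ := e.exists_rep
    rw [finiteBD_prefix_iff hN] at he1 he2
    have h1 := he1 s
    have h2 := he2 s
    rw [P.trace_restrict hN] at h1
    rw [Q.trace_eq hN hσ hf] at h2
    exact List.suffix_or_suffix_of_suffix h1 h2
  refine P.not_isMaximal_of_history hτ (t := Q.πT t) (α := α.map Q.πT)
    (History.fireable (σ := t :: α) (hα.choose_spec ▸ hσ : Q.net.History (_ ++ _)).of_append)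
    hle ?_ hP
  intro κ hκ
  have hleκ : ∀ s, N.proj s (α.map Q.πT) <:+ N.proj s ((κ ++ τ).map P.πT) := fun s =>
    (hle s).trans (by rw [List.map_append]; exact proj_suffix (List.suffix_append ..) s)
  have hdich : ∀ s, 0 < N.pre s (Q.πT t) →
      N.proj s ((κ ++ τ).map P.πT) = N.proj s (α.map Q.πT) ∨
        Q.πT t :: N.proj s (α.map Q.πT) <:+ N.proj s ((κ ++ τ).map P.πT) := by
    intro s hs
    have h1 : Q.πT t :: N.proj s (α.map Q.πT) <:+ N.proj s (σ.map Q.πT) := by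
      rw [← proj_cons_of_pos hs, ← List.map_cons]
      exact proj_suffix (hα.map _) s
    rcases hcompat _ hκ s with h2 | h2
    · rcases List.suffix_or_suffix_of_suffix h2 h1 with h3 | h3
      · rcases List.suffix_cons_iff.1 h3 with h4 | h4
        · exact Or.inr (h4 ▸ List.suffix_rfl)
        · exact Or.inl (h4.eq_of_length_le (hleκ s).length_le)
      · exact Or.inr h3
    · exact Or.inr (h1.trans h2)
  by_contra! hne
  obtain ⟨s₁, hs₁, hne⟩ := hne
  -- Occurrences of `Q.πT t` can be counted in the projection to any of its preplaces. A surplus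
  -- seen at `s₁` therefore rules out equality with `α` at every other preplace, so `κ ++ τ` covers
  -- `t :: α`, against the choice of `t`.
  have hcount : (α.map Q.πT).count (Q.πT t) < ((κ ++ τ).map P.πT).count (Q.πT t) := by
    have h1 := ((hdich s₁ hs₁).resolve_left hne).sublist.count_le (Q.πT t)
    rw [List.count_cons_self, count_proj hs₁, count_proj hs₁] at h1
    omega
  refine hno ⟨κ ++ τ, hκ, fun s => ?_⟩
  rw [List.map_cons]
  by_cases hs : 0 < N.pre s (Q.πT t)
  · rw [proj_cons_of_pos hs]
    refine (hdich s hs).resolve_left fun h1 => hcount.ne ?_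
    rw [← count_proj hs, ← h1, count_proj hs]
  · rw [proj_cons_of_not_pos hs]
    exact hleκ s

end PetriNet

theorem mainTheorem5 (N : PetriNet.{u}) (hN : N.IsStructuralConflictNet)
    (P : PetriNet.GRProcess N) :
    (¬ PetriNet.IsMaximalBDRun P.BD → ¬ P.IsMaximal) ∧
      (P.bdClass.WeaklyMaximal → P.bdClass.RunMaximal) := by
  refine ⟨fun h hP => h (hP.isMaximalBDRun hN), ?_⟩
  rintro ⟨P', hP', hmax⟩
  rw [← hP']
  exact hmax.isMaximalBDRun hN
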